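/- Let $T$ be an integral domain, $M$ a nonzero maximal ideal of $T$, $k := T/M$ its residue field, $\varphi : T \to k$ the canonical projection, $D$ a proper subring of $k$ whose quotient field is $k$, and $R := \varphi^{-1}(D)$. (This is a "pullback of type $(\square^+)$"; $R$ and $T$ have the same quotient field $K$, and $(R:T)=M\neq 0$.) Write $\mathcal U(A)$ for the group of units of a ring $A$ and $k^\bullet := k\setminus\{0\}$. For an integral domain $A$ with quotient field $L$ and a star operation $\star$ on $A$, let $\mathrm{Inv}^\star(A)$ be the abelian group of all nonzero fractional ideals $I$ of $A$ with $I^\star = I$ and $(II^{-1})^\star = A$, under the multiplication $(I,J)\mapsto (IJ)^\star$; let $\mathrm{Prin}(A)$ be its subgroup of nonzero principal fractional ideals, and $\mathrm{Cl}^\star(A) := \mathrm{Inv}^\star(A)/\mathrm{Prin}(A)$. Let $v_A$ be the star operation $E\mapsto (A:_L(A:_L E))$ and $t_A$ the star operation $E\mapsto \bigcup\{F^{v_A} \mid 0\neq F\subseteq E,\ F \text{ finitely generated}\}$. Let $(t_R)_T$ be the star operation on $T$ given by $E^{(t_R)_T} := E^{t_R}\cap E^{v_T}$ for each nonzero fractional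 ideal $E$ of $T$ (which is also a fractional ideal of $R$). Suppose that the canonical homomorphism $\mathcal U(T)\to k^\bullet/\mathcal U(D)$, $u\mapsto \varphi(u)\,\mathcal U(D)$, is surjective. Then $\overline{\boldsymbol\alpha} : [J]\mapsto[\varphi^{-1}(J)]$ and $\overline{\boldsymbol\beta} : [H]\mapsto [HT]$ are well-defined group homomorphisms, and the sequence $$0\longrightarrow \mathrm{Cl}^{t_D}(D)\stackrel{\overline{\boldsymbol\alpha}}{\longrightarrow}\mathrm{Cl}^{t_R}(R)\stackrel{\overline{\boldsymbol\beta}}{\longrightarrow}\mathrm{Cl}^{(t_R)_T}(T)\longrightarrow 0$$ is split exact. -/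

import Mathlib

open scoped nonZeroDivisors

/-- A star operation on a domain `A` with quotient field `K`.  The elements of `FractionalIdeal A⁰ K`
are the fractional ideals of `A`, the zero ideal included; a star operation only concerns the nonzero
ones, and `star_zero` just normalizes its value at the zero ideal. -/
@[ext]
structure StarOperation (A K : Type*) [CommRing A] [Field K] [Algebra A K] [IsFractionRing A K] where
  toFun : FractionalIdeal A⁰ K → FractionalIdeal A⁰ K
  star_zero : toFun 0 = 0
  star_one : toFun 1 = 1
  star_smul : ∀ (x : K) (E : FractionalIdeal A⁰ K), x ≠ 0 →
    toFun (FractionalIdeal.spanSingleton A⁰ x * E) = FractionalIdeal.spanSingleton A⁰ x * toFun E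
  mono : ∀ E F : FractionalIdeal A⁰ K, E ≤ F → toFun E ≤ toFun F
  le_self : ∀ E : FractionalIdeal A⁰ K, E ≤ toFun E
  idem : ∀ E : FractionalIdeal A⁰ K, toFun (toFun E) = toFun E

namespace StarOperation

section Basic

variable {A K : Type*} [CommRing A] [Field K] [Algebra A K] [IsFractionRing A K]

instance : CoeFun (StarOperation A K) fun _ => FractionalIdeal A⁰ K → FractionalIdeal A⁰ K :=
  ⟨toFun⟩

variable (s : StarOperation A K)

theorem smul_mem {x y : K} {E : FractionalIdeal A⁰ K} (hy : y ∈ s E) :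
    x * y ∈ s (FractionalIdeal.spanSingleton A⁰ x * E) := by
  by_cases hx : x = 0
  · subst hx
    rw [zero_mul]
    exact Submodule.zero_mem (s (FractionalIdeal.spanSingleton A⁰ 0 * E) : Submodule A K)
  · rw [s.star_smul x E hx]
    exact FractionalIdeal.mul_mem_mul (FractionalIdeal.mem_spanSingleton_self _ x) hy

theorem star_spanSingleton {x : K} (hx : x ≠ 0) :
    s (FractionalIdeal.spanSingleton A⁰ x) = FractionalIdeal.spanSingleton A⁰ x := by
  have h := s.star_smul x 1 hx
  rwa [mul_one, s.star_one, mul_one] at h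

theorem mul_le_star (I J : FractionalIdeal A⁰ K) : s I * J ≤ s (I * J) := by
  rw [FractionalIdeal.mul_le]
  intro x hx y hy
  have h1 : y * x ∈ s (FractionalIdeal.spanSingleton A⁰ y * I) := s.smul_mem hx
  have h2 : FractionalIdeal.spanSingleton A⁰ y * I ≤ I * J := by
    rw [mul_comm I J]
    exact mul_le_mul_left (FractionalIdeal.spanSingleton_le_iff_mem.2 hy) I
  rw [mul_comm x y]
  exact s.mono _ _ h2 h1

theorem star_mul_left (I J : FractionalIdeal A⁰ K) : s (s I * J) = s (I * J) := by
  apply le_antisymm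
  · calc s (s I * J) ≤ s (s (I * J)) := s.mono _ _ (s.mul_le_star I J)
      _ = s (I * J) := s.idem _
  · exact s.mono _ _ (mul_le_mul_left (s.le_self I) J)

theorem star_mul_right (I J : FractionalIdeal A⁰ K) : s (I * s J) = s (I * J) := by
  rw [mul_comm, star_mul_left, mul_comm]

/-- The star operation of finite type associated to `s`: `E` is sent to the union of all `F ^ s`,
where `F ⊆ E` is finitely generated.  (Admitting `F = 0` changes the union only for `E = 0`.) -/
def finiteType : StarOperation A K := by
  let f : FractionalIdeal A⁰ K → FractionalIdeal A⁰ K := fun E =>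
    ⟨{  carrier := {x | ∃ F : FractionalIdeal A⁰ K, (F : Submodule A K).FG ∧ F ≤ E ∧ x ∈ s F}
        zero_mem' := ⟨0, by rw [FractionalIdeal.coe_zero]; exact Submodule.fg_bot,
          FractionalIdeal.zero_le E, Submodule.zero_mem (s 0 : Submodule A K)⟩
        add_mem' := by
          rintro x y ⟨F, hF, hFE, hx⟩ ⟨G, hG, hGE, hy⟩
          refine ⟨F ⊔ G, ?_, sup_le hFE hGE, ?_⟩
          · rw [FractionalIdeal.coe_sup]
            exact hF.sup hG
          · exact Submodule.add_mem (s (F ⊔ G) : Submodule A K)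
              (s.mono _ _ le_sup_left hx) (s.mono _ _ le_sup_right hy)
        smul_mem' := by
          rintro a x ⟨F, hF, hFE, hx⟩
          exact ⟨F, hF, hFE, Submodule.smul_mem (s F : Submodule A K) a hx⟩ },
      by
        obtain ⟨a, ha, h⟩ := (s E).isFractional
        refine ⟨a, ha, ?_⟩
        rintro x ⟨F, hF, hFE, hx⟩
        exact h x (s.mono _ _ hFE hx)⟩
  have mem_f : ∀ (E : FractionalIdeal A⁰ K) (x : K), x ∈ f E ↔
      ∃ F : FractionalIdeal A⁰ K, (F : Submodule A K).FG ∧ F ≤ E ∧ x ∈ s F := fun E x => Iff.rfl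
  have f_le : ∀ E, f E ≤ s E := by
    intro E x hx
    obtain ⟨F, hF, hFE, hx⟩ := hx
    exact s.mono _ _ hFE hx
  have f_mono : ∀ E F : FractionalIdeal A⁰ K, E ≤ F → f E ≤ f F := by
    intro E F h x hx
    obtain ⟨G, hG, hGE, hx⟩ := hx
    exact ⟨G, hG, hGE.trans h, hx⟩
  have le_f : ∀ E, E ≤ f E := by
    intro E x hx
    refine ⟨FractionalIdeal.spanSingleton A⁰ x, ?_, FractionalIdeal.spanSingleton_le_iff_mem.2 hx,
      s.le_self _ (FractionalIdeal.mem_spanSingleton_self _ x)⟩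
    rw [FractionalIdeal.coe_spanSingleton]
    exact Submodule.fg_span_singleton x
  have smul_le : ∀ (x : K) (E : FractionalIdeal A⁰ K),
      FractionalIdeal.spanSingleton A⁰ x * f E ≤ f (FractionalIdeal.spanSingleton A⁰ x * E) := by
    intro x E
    rw [FractionalIdeal.spanSingleton_mul_le_iff]
    rintro z ⟨F, hF, hFE, hz⟩
    refine ⟨FractionalIdeal.spanSingleton A⁰ x * F, ?_, mul_le_mul_right hFE _, s.smul_mem hz⟩
    rw [FractionalIdeal.coe_mul, FractionalIdeal.coe_spanSingleton]
    exact (Submodule.fg_span_singleton x).mul hF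
  exact
  { toFun := f
    star_zero := le_antisymm ((f_le 0).trans s.star_zero.le) (FractionalIdeal.zero_le _)
    star_one := le_antisymm ((f_le 1).trans s.star_one.le) (le_f 1)
    star_smul := by
      intro x E hx
      apply le_antisymm _ (smul_le x E)
      have hxx : FractionalIdeal.spanSingleton A⁰ x * FractionalIdeal.spanSingleton A⁰ x⁻¹ = 1 := by
        rw [FractionalIdeal.spanSingleton_mul_spanSingleton, mul_inv_cancel₀ hx,
          FractionalIdeal.spanSingleton_one]
      have h := mul_le_mul_right (smul_le x⁻¹ (FractionalIdeal.spanSingleton A⁰ x * E))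
        (FractionalIdeal.spanSingleton A⁰ x)
      rw [← mul_assoc, hxx, one_mul, ← mul_assoc,
        mul_comm (FractionalIdeal.spanSingleton A⁰ x⁻¹), hxx, one_mul] at h
      exact h
    mono := f_mono
    le_self := le_f
    idem := by
      intro E
      refine le_antisymm ?_ (le_f _)
      rintro x ⟨F, hF, hFE, hx⟩
      suffices h : ∀ N : Submodule A K, N.FG → (∀ y ∈ N, y ∈ f E) →
          ∃ G : FractionalIdeal A⁰ K, (G : Submodule A K).FG ∧ G ≤ E ∧ ∀ y ∈ N, y ∈ s G by
        obtain ⟨G, hG, hGE, hFG⟩ := h F hF fun y hy => hFE hy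
        refine ⟨G, hG, hGE, ?_⟩
        rw [← s.idem G]
        exact s.mono _ _ (fun y hy => hFG y hy) hx
      intro N hN
      induction N, hN using Submodule.fg_induction with
      | singleton y =>
        intro h
        obtain ⟨G, hG, hGE, hy⟩ := h y (Submodule.mem_span_singleton_self y)
        refine ⟨G, hG, hGE, ?_⟩
        intro z hz
        have : Submodule.span A {y} ≤ (s G : Submodule A K) := by
          rw [Submodule.span_singleton_le_iff_mem]
          exact hy
        exact this hz
      | sup N₁ N₂ h₁ h₂ ih₁ ih₂ =>
        intro h
        obtain ⟨G₁, hG₁, hGE₁, hy₁⟩ := ih₁ fun y hy => h y (Submodule.mem_sup_left hy)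
        obtain ⟨G₂, hG₂, hGE₂, hy₂⟩ := ih₂ fun y hy => h y (Submodule.mem_sup_right hy)
        refine ⟨G₁ ⊔ G₂, ?_, sup_le hGE₁ hGE₂, ?_⟩
        · rw [FractionalIdeal.coe_sup]
          exact hG₁.sup hG₂
        · intro y hy
          obtain ⟨a, ha, b, hb, rfl⟩ := Submodule.mem_sup.1 hy
          exact Submodule.add_mem (s (G₁ ⊔ G₂) : Submodule A K)
            (s.mono _ _ le_sup_left (hy₁ a ha)) (s.mono _ _ le_sup_right (hy₂ b hb)) }

theorem mem_finiteType {E : FractionalIdeal A⁰ K} {x : K} : x ∈ s.finiteType E ↔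
    ∃ F : FractionalIdeal A⁰ K, (F : Submodule A K).FG ∧ F ≤ E ∧ x ∈ s F := Iff.rfl

end Basic

section ClassGroup

variable {A K : Type*} [CommRing A] [IsDomain A] [Field K] [Algebra A K] [IsFractionRing A K]

theorem le_inv_inv (E : FractionalIdeal A⁰ K) : E ≤ E⁻¹⁻¹ := by
  by_cases h : E⁻¹ = 0
  · by_cases hE : E = 0
    · rw [hE]
      exact FractionalIdeal.zero_le _
    · exfalso
      obtain ⟨a, ha, hEa⟩ := E.isFractional
      have : algebraMap A K a ∈ E⁻¹ := by
        rw [FractionalIdeal.mem_inv_iff hE]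
        intro y hy
        obtain ⟨b, hb⟩ := hEa y hy
        rw [FractionalIdeal.mem_one_iff]
        exact ⟨b, by rw [hb, Algebra.smul_def]⟩
      rw [h, FractionalIdeal.mem_zero_iff] at this
      exact nonZeroDivisors.ne_zero ha
        ((map_eq_zero_iff _ (IsFractionRing.injective A K)).1 this)
  · rw [FractionalIdeal.inv_eq (I := E⁻¹), FractionalIdeal.le_div_iff_mul_le h]
    exact FractionalIdeal.mul_one_div_le_one

variable (A K) in
/-- The `v`-operation `E ↦ (A : (A : E))`. -/
noncomputable def vOp : StarOperation A K := by
  have inv_ne : ∀ E : FractionalIdeal A⁰ K, E ≠ 0 → E⁻¹ ≠ 0 := by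
    intro E hE h
    have := le_inv_inv E
    rw [h, FractionalIdeal.inv_zero'] at this
    exact hE (le_antisymm this (FractionalIdeal.zero_le _))
  have inv_anti : ∀ E F : FractionalIdeal A⁰ K, E ≠ 0 → E ≤ F → F⁻¹ ≤ E⁻¹ := by
    intro E F hE h
    refine FractionalIdeal.inv_anti_mono hE ?_ h
    rintro rfl
    exact hE (le_antisymm h (FractionalIdeal.zero_le _))
  have inv_smul : ∀ (x : K) (E : FractionalIdeal A⁰ K), x ≠ 0 →
      (FractionalIdeal.spanSingleton A⁰ x * E)⁻¹ = FractionalIdeal.spanSingleton A⁰ x⁻¹ * E⁻¹ := by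
    intro x E hx
    by_cases hE : E = 0
    · rw [hE, mul_zero, FractionalIdeal.inv_zero', mul_zero]
    have hxE : FractionalIdeal.spanSingleton A⁰ x * E ≠ 0 := by
      intro h
      apply hE
      rw [← one_mul E, ← FractionalIdeal.spanSingleton_one, ← inv_mul_cancel₀ hx,
        ← FractionalIdeal.spanSingleton_mul_spanSingleton, mul_assoc, h, mul_zero]
    ext y
    rw [FractionalIdeal.mem_inv_iff hxE, FractionalIdeal.mem_singleton_mul]
    constructor
    · intro h
      refine ⟨x * y, ?_, by field_simp⟩
      rw [FractionalIdeal.mem_inv_iff hE]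
      intro z hz
      have := h (x * z) (FractionalIdeal.mul_mem_mul (FractionalIdeal.mem_spanSingleton_self _ x) hz)
      rwa [show x * y * z = y * (x * z) by ring]
    · rintro ⟨w, hw, rfl⟩ z hz
      obtain ⟨u, hu, rfl⟩ := FractionalIdeal.mem_singleton_mul.1 hz
      have := (FractionalIdeal.mem_inv_iff hE).1 hw u hu
      rwa [show x⁻¹ * w * (x * u) = w * u by field_simp]
  exact
  { toFun := fun E => E⁻¹⁻¹
    star_zero := by simp only [FractionalIdeal.inv_zero']
    star_one := by simp only [FractionalIdeal.inv_eq, FractionalIdeal.div_one]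
    star_smul := by
      intro x E hx
      rw [inv_smul x E hx, inv_smul _ _ (inv_ne_zero hx), inv_inv]
    mono := by
      intro E F h
      by_cases hE : E = 0
      · rw [hE, FractionalIdeal.inv_zero', FractionalIdeal.inv_zero']
        exact FractionalIdeal.zero_le _
      have hF : F ≠ 0 := by
        rintro rfl
        exact hE (le_antisymm h (FractionalIdeal.zero_le _))
      exact inv_anti _ _ (inv_ne F hF) (inv_anti E F hE h)
    le_self := le_inv_inv
    idem := by
      intro E
      by_cases hE : E = 0
      · simp only [hE, FractionalIdeal.inv_zero']
      have h : E⁻¹⁻¹⁻¹ = E⁻¹ := le_antisymm (inv_anti _ _ hE (le_inv_inv E)) (le_inv_inv _)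
      rw [h] }

theorem vOp_apply (E : FractionalIdeal A⁰ K) : vOp A K E = E⁻¹⁻¹ := rfl

variable (A K) in
/-- The `t`-operation, the star operation of finite type associated to the `v`-operation. -/
noncomputable def tOp : StarOperation A K := (vOp A K).finiteType

variable (s : StarOperation A K)

/-- `Inv^s(A)`: the set of all `s`-invertible `s`-ideals of `A`.  (They are nonzero, since
`s (0 * 0⁻¹) = 0`.)  It is a group under `(I, J) ↦ (I J) ^ s`. -/
def InvGroup : Type _ := {I : FractionalIdeal A⁰ K // s I = I ∧ s (I * I⁻¹) = 1}

namespace InvGroup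

variable {s}

/-- The fractional ideal underlying an element of `Inv^s(A)`. -/
def ideal (I : s.InvGroup) : FractionalIdeal A⁰ K := I.1

theorem ext_ideal {I J : s.InvGroup} (h : I.ideal = J.ideal) : I = J := Subtype.ext h

theorem mul_inv_le (I : FractionalIdeal A⁰ K) : I * I⁻¹ ≤ 1 := FractionalIdeal.mul_one_div_le_one

theorem ne_zero_of_star {I : FractionalIdeal A⁰ K} (h : s (I * I⁻¹) = 1) : I ≠ 0 := by
  rintro rfl
  rw [zero_mul, s.star_zero] at h
  exact zero_ne_one h

theorem le_inv_of_mul_le {I J : FractionalIdeal A⁰ K} (hI : I ≠ 0) (h : J * I ≤ 1) : J ≤ I⁻¹ := by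
  rw [FractionalIdeal.inv_eq, FractionalIdeal.le_div_iff_mul_le hI]
  exact h

/-- `s`-ideals with an inverse for the `s`-multiplication are `s`-invertible. -/
theorem star_mul_inv_of_mul {I J : FractionalIdeal A⁰ K} (h : s (I * J) = 1) :
    s (I * I⁻¹) = 1 := by
  have hI : I ≠ 0 := by
    rintro rfl
    rw [zero_mul, s.star_zero] at h
    exact zero_ne_one h
  have hJ : J ≤ I⁻¹ := le_inv_of_mul_le hI (by rw [mul_comm, ← h]; exact s.le_self _)
  apply le_antisymm
  · exact (s.mono _ _ (mul_inv_le I)).trans s.star_one.le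
  · rw [← h]
    exact s.mono _ _ (mul_le_mul_right hJ I)

noncomputable instance : CommGroup s.InvGroup where
  mul I J := ⟨s (I.1 * J.1), s.idem _, by
    apply star_mul_inv_of_mul (J := I.1⁻¹ * J.1⁻¹)
    rw [s.star_mul_left, mul_mul_mul_comm, ← s.star_mul_left, I.2.2, one_mul, J.2.2]⟩
  one := ⟨1, s.star_one, by rw [FractionalIdeal.inv_eq, FractionalIdeal.div_one, one_mul, s.star_one]⟩
  inv I := ⟨I.1⁻¹, by
      refine le_antisymm (le_inv_of_mul_le (ne_zero_of_star I.2.2) ?_) (s.le_self _)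
      refine (s.mul_le_star _ _).trans ?_
      rw [mul_comm, I.2.2],
    star_mul_inv_of_mul (J := I.1) (by rw [mul_comm, I.2.2])⟩
  mul_assoc I J L := Subtype.ext (by
    change s (s (I.1 * J.1) * L.1) = s (I.1 * s (J.1 * L.1))
    rw [s.star_mul_left, s.star_mul_right, mul_assoc])
  one_mul I := Subtype.ext (by
    change s (1 * I.1) = I.1
    rw [one_mul, I.2.1])
  mul_one I := Subtype.ext (by
    change s (I.1 * 1) = I.1
    rw [mul_one, I.2.1])
  inv_mul_cancel I := Subtype.ext (by
    change s (I.1⁻¹ * I.1) = 1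
    rw [mul_comm, I.2.2])
  mul_comm I J := Subtype.ext (by
    change s (I.1 * J.1) = s (J.1 * I.1)
    rw [mul_comm])

theorem ideal_mul (I J : s.InvGroup) : (I * J).ideal = s (I.ideal * J.ideal) := rfl

theorem ideal_one : (1 : s.InvGroup).ideal = 1 := rfl

theorem ideal_inv (I : s.InvGroup) : (I⁻¹).ideal = (I.ideal)⁻¹ := rfl

end InvGroup

/-- `Prin(A)`: the subgroup of `Inv^s(A)` of all nonzero principal fractional ideals of `A`. -/
def prin : Subgroup s.InvGroup where
  carrier := {I | ∃ x : K, x ≠ 0 ∧ I.ideal = FractionalIdeal.spanSingleton A⁰ x}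
  one_mem' := ⟨1, one_ne_zero, by
    rw [FractionalIdeal.spanSingleton_one]
    exact InvGroup.ideal_one⟩
  mul_mem' := by
    rintro I J ⟨x, hx, hI⟩ ⟨y, hy, hJ⟩
    exact ⟨x * y, mul_ne_zero hx hy, by
      rw [InvGroup.ideal_mul, hI, hJ, FractionalIdeal.spanSingleton_mul_spanSingleton,
        s.star_spanSingleton (mul_ne_zero hx hy)]⟩
  inv_mem' := by
    rintro I ⟨x, hx, hI⟩
    exact ⟨x⁻¹, inv_ne_zero hx, by
      rw [InvGroup.ideal_inv, hI, FractionalIdeal.spanSingleton_inv]⟩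

/-- `Cl^s(A) = Inv^s(A) / Prin(A)`, the class group of `A` with respect to `s`. -/
abbrev Cl : Type _ := s.InvGroup ⧸ s.prin

/-- The class of an `s`-invertible `s`-ideal. -/
noncomputable def cl : s.InvGroup →* s.Cl := QuotientGroup.mk' s.prin

end ClassGroup

section Overring

/-- The `T`-module `H T` generated by a fractional ideal `H` of `R`, where `R ⊆ T ⊆ K`. -/
def extendIdeal {R K : Type*} (T : Type*) [CommRing R] [CommRing T] [Field K] [Algebra R T]
    [Algebra R K] [Algebra T K] [IsScalarTower R T K] [IsFractionRing R K] [IsFractionRing T K]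
    (H : FractionalIdeal R⁰ K) : FractionalIdeal T⁰ K :=
  ⟨Submodule.span T {x | x ∈ H}, by
    obtain ⟨a, ha, h⟩ := H.isFractional
    have haK : algebraMap R K a ≠ 0 := by
      have : Nontrivial R := (algebraMap R K).domain_nontrivial
      intro h0
      exact nonZeroDivisors.ne_zero ha
        ((map_eq_zero_iff _ (IsFractionRing.injective R K)).1 h0)
    rw [FractionalIdeal.isFractional_span_iff]
    refine ⟨algebraMap R T a, ?_, ?_⟩
    · have : IsDomain T := (IsFractionRing.injective T K).isDomain
      rw [mem_nonZeroDivisors_iff_ne_zero]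
      intro h0
      rw [IsScalarTower.algebraMap_apply R T K, h0, map_zero] at haK
      exact haK rfl
    · intro b hb
      obtain ⟨r, hr⟩ := h b hb
      refine ⟨algebraMap R T r, ?_⟩
      rw [algebraMap_smul, ← hr, ← IsScalarTower.algebraMap_apply]⟩

/-- The conductor `(R : T)` is nonzero. -/
def ConductorNeZero (R T : Type*) [CommRing R] [CommRing T] [Algebra R T] : Prop :=
  ∃ c : R, c ≠ 0 ∧ ∀ t : T, ∃ r : R, algebraMap R T r = c • t

variable {R T K : Type*} [CommRing R] [CommRing T] [IsDomain R] [IsDomain T] [Field K] [Algebra R T]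
  [Algebra R K] [Algebra T K] [IsScalarTower R T K] [IsFractionRing R K] [IsFractionRing T K]

/-- A fractional ideal of `T`, seen as a fractional ideal of `R`; here `R ⊆ T ⊆ K` and
`(R : T) ≠ 0`. -/
def restrictIdeal (hc : ConductorNeZero R T) (E : FractionalIdeal T⁰ K) : FractionalIdeal R⁰ K :=
  ⟨(E : Submodule T K).restrictScalars R, by
    obtain ⟨c, hc0, hc⟩ := hc
    obtain ⟨a, ha, h⟩ := E.isFractional
    have injT := IsFractionRing.injective T K
    have injR : Function.Injective (algebraMap R T) := by
      have : Function.Injective (algebraMap R K) := IsFractionRing.injective R K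
      rw [IsScalarTower.algebraMap_eq R T K] at this
      exact Function.Injective.of_comp this
    obtain ⟨r, hr⟩ := hc a
    refine ⟨c * r, ?_, ?_⟩
    · rw [mem_nonZeroDivisors_iff_ne_zero]
      refine mul_ne_zero hc0 ?_
      rintro rfl
      rw [map_zero, Algebra.smul_def] at hr
      exact mul_ne_zero ((map_ne_zero_iff _ injR).2 hc0) (nonZeroDivisors.ne_zero ha) hr.symm
    · intro b hb
      obtain ⟨t, ht⟩ := h b hb
      obtain ⟨u, hu⟩ := hc (c • t)
      refine ⟨u, ?_⟩
      rw [IsScalarTower.algebraMap_apply R T K, hu, Algebra.smul_def (c * r) b,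
        IsScalarTower.algebraMap_apply R T K, map_mul, hr]
      simp only [Algebra.smul_def, map_mul] at ht ⊢
      rw [ht]
      simp only [← IsScalarTower.algebraMap_apply R T K]
      ring⟩

/-- The star operation `E ↦ E ^ s ∩ E ^ v_T` on the overring `T` of `R`, where `s` is a star
operation on `R` and `(R : T) ≠ 0`. -/
noncomputable def extendStar (s : StarOperation R K) (hc : ConductorNeZero R T) :
    StarOperation T K := by
  have mem_restrict : ∀ (E : FractionalIdeal T⁰ K) (x : K), x ∈ restrictIdeal hc E ↔ x ∈ E :=
    fun E x => Iff.rfl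
  have restrict_mono : ∀ E F : FractionalIdeal T⁰ K, E ≤ F →
      restrictIdeal hc E ≤ restrictIdeal hc F := fun E F h x hx => h hx
  have restrict_smul : ∀ (x : K) (E : FractionalIdeal T⁰ K),
      restrictIdeal hc (FractionalIdeal.spanSingleton T⁰ x * E) =
        FractionalIdeal.spanSingleton R⁰ x * restrictIdeal hc E := by
    intro x E
    ext y
    rw [mem_restrict, FractionalIdeal.mem_singleton_mul, FractionalIdeal.mem_singleton_mul]
    rfl
  let f : FractionalIdeal T⁰ K → FractionalIdeal T⁰ K := fun E =>
    ⟨{  carrier := {x | x ∈ s (restrictIdeal hc E) ∧ x ∈ vOp T K E}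
        zero_mem' := ⟨Submodule.zero_mem (s (restrictIdeal hc E) : Submodule R K),
          Submodule.zero_mem (vOp T K E : Submodule T K)⟩
        add_mem' := fun hx hy =>
          ⟨Submodule.add_mem (s (restrictIdeal hc E) : Submodule R K) hx.1 hy.1,
            Submodule.add_mem (vOp T K E : Submodule T K) hx.2 hy.2⟩
        smul_mem' := by
          rintro t x ⟨h1, h2⟩
          refine ⟨?_, Submodule.smul_mem (vOp T K E : Submodule T K) t h2⟩
          rw [Algebra.smul_def]
          refine s.mono _ _ ?_ (s.smul_mem h1)
          rw [← restrict_smul]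
          apply restrict_mono
          rw [FractionalIdeal.spanSingleton_mul_le_iff]
          intro z hz
          rw [← Algebra.smul_def]
          exact Submodule.smul_mem (E : Submodule T K) t hz },
      by
        obtain ⟨a, ha, h⟩ := (vOp T K E).isFractional
        exact ⟨a, ha, fun x hx => h x hx.2⟩⟩
  have mem_f : ∀ (E : FractionalIdeal T⁰ K) (x : K),
      x ∈ f E ↔ x ∈ s (restrictIdeal hc E) ∧ x ∈ vOp T K E := fun E x => Iff.rfl
  have f_le : ∀ E, f E ≤ vOp T K E := fun E x hx => hx.2
  have le_f : ∀ E, E ≤ f E := fun E x hx => ⟨s.le_self _ hx, (vOp T K).le_self E hx⟩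
  have f_mono : ∀ E F : FractionalIdeal T⁰ K, E ≤ F → f E ≤ f F := fun E F h x hx =>
    ⟨s.mono _ _ (restrict_mono E F h) hx.1, (vOp T K).mono _ _ h hx.2⟩
  exact
  { toFun := f
    star_zero := le_antisymm ((f_le 0).trans (vOp T K).star_zero.le) (FractionalIdeal.zero_le _)
    star_one := le_antisymm ((f_le 1).trans (vOp T K).star_one.le) (le_f 1)
    star_smul := by
      intro x E hx
      ext y
      rw [mem_f, restrict_smul, s.star_smul x _ hx, (vOp T K).star_smul x E hx,
        FractionalIdeal.mem_singleton_mul, FractionalIdeal.mem_singleton_mul,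
        FractionalIdeal.mem_singleton_mul]
      constructor
      · rintro ⟨⟨a, ha, rfl⟩, b, hb, hab⟩
        rw [mul_left_cancel₀ hx hab] at ha
        exact ⟨b, ⟨ha, hb⟩, hab⟩
      · rintro ⟨a, ha, rfl⟩
        exact ⟨⟨a, ha.1, rfl⟩, a, ha.2, rfl⟩
    mono := f_mono
    le_self := le_f
    idem := by
      intro E
      refine le_antisymm (fun x hx => ⟨?_, ?_⟩) (le_f _)
      · rw [← s.idem]
        exact s.mono _ _ (fun y hy => ((mem_f E y).1 hy).1) hx.1
      · rw [← (vOp T K).idem]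
        exact (vOp T K).mono _ _ (f_le E) hx.2 }

theorem mem_extendStar (s : StarOperation R K) (hc : ConductorNeZero R T)
    {E : FractionalIdeal T⁰ K} {x : K} :
    x ∈ s.extendStar hc E ↔ x ∈ s (restrictIdeal hc E) ∧ x ∈ vOp T K E := Iff.rfl

end Overring

end StarOperation

/-- A pullback of type `(□⁺)` on the domain `T`: a surjective homomorphism `φ : T → k` onto a field
whose kernel `M` is a nonzero (maximal) ideal of `T`, so that `φ` identifies `k` with `T / M`, and a
proper subring `D` of `k` such that `k` is the quotient field of `D`. -/
structure PullbackSquarePlus (T k : Type*) [CommRing T] [Field k] where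
  φ : T →+* k
  surjective : Function.Surjective φ
  ker_ne_bot : RingHom.ker φ ≠ ⊥
  D : Subring k
  D_ne_top : D ≠ ⊤
  isFractionRing : IsFractionRing D k

namespace PullbackSquarePlus

open StarOperation

variable {T k : Type*} [CommRing T] [Field k] (P : PullbackSquarePlus T k)

instance : IsFractionRing P.D k := P.isFractionRing

/-- The ring `R = φ⁻¹(D)`. -/
abbrev R : Subring T := P.D.comap P.φ

/-- The canonical map `U(T) → kˣ / U(D)`, `u ↦ φ(u) U(D)`. -/
def unitsMap : Tˣ →* kˣ ⧸ (Units.map (P.D.subtype : P.D →* k)).range :=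
  (QuotientGroup.mk' _).comp (Units.map (P.φ : T →* k))

theorem exists_ker : ∃ m : T, m ≠ 0 ∧ P.φ m = 0 := by
  obtain ⟨m, hm, hm0⟩ := (Submodule.ne_bot_iff _).1 P.ker_ne_bot
  exact ⟨m, hm0, hm⟩

theorem mem_R_of_ker {m : T} (hm : P.φ m = 0) : m ∈ P.R := by
  change P.φ m ∈ P.D
  rw [hm]
  exact P.D.zero_mem

theorem conductorNeZero : ConductorNeZero P.R T := by
  obtain ⟨m, hm0, hm⟩ := P.exists_ker
  refine ⟨⟨m, P.mem_R_of_ker hm⟩, fun h => hm0 (congrArg Subtype.val h), fun t => ?_⟩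
  exact ⟨⟨m * t, P.mem_R_of_ker (by rw [map_mul, hm, zero_mul])⟩, rfl⟩

section

variable {K : Type*} [IsDomain T] [Field K] [Algebra T K] [IsFractionRing T K]

/-- The quotient field `K` of `T` is also the quotient field of `R`. -/
instance : IsFractionRing P.R K := by
  have inj : Function.Injective (algebraMap P.R K) := fun a b h =>
    Subtype.ext (IsFractionRing.injective T K h)
  obtain ⟨m, hm0, hm⟩ := P.exists_ker
  refine IsFractionRing.of_field P.R K fun z => ?_
  obtain ⟨a, b, hb, rfl⟩ := IsFractionRing.div_surjective (A := T) z
  refine ⟨⟨a * m, P.mem_R_of_ker (by rw [map_mul, hm, mul_zero])⟩,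
    ⟨b * m, P.mem_R_of_ker (by rw [map_mul, hm, mul_zero])⟩, ?_⟩
  change _ = algebraMap T K (a * m) / algebraMap T K (b * m)
  have hmK : algebraMap T K m ≠ 0 := (map_ne_zero_iff _ (IsFractionRing.injective T K)).2 hm0
  rw [map_mul, map_mul, mul_div_mul_right _ _ hmK]

variable (K) in
/-- The inverse image `φ⁻¹(J)` in `T ⊆ K` of a fractional ideal `J ⊆ k` of `D`, a fractional ideal
of `R`. -/
def preimage (J : FractionalIdeal P.D⁰ k) : FractionalIdeal P.R⁰ K :=
  ⟨{  carrier := {x | ∃ t : T, P.φ t ∈ J ∧ algebraMap T K t = x}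
      zero_mem' := ⟨0, by
        rw [map_zero]
        exact Submodule.zero_mem (J : Submodule P.D k), map_zero _⟩
      add_mem' := by
        rintro x y ⟨t, ht, rfl⟩ ⟨u, hu, rfl⟩
        refine ⟨t + u, ?_, map_add _ _ _⟩
        rw [map_add]
        exact Submodule.add_mem (J : Submodule P.D k) ht hu
      smul_mem' := by
        rintro ⟨r, hr⟩ x ⟨t, ht, rfl⟩
        refine ⟨r * t, ?_, ?_⟩
        · rw [map_mul]
          exact Submodule.smul_mem (J : Submodule P.D k) (⟨P.φ r, hr⟩ : P.D) ht
        · rw [map_mul]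
          rw [Algebra.smul_def]
          rfl },
    by
      obtain ⟨m, hm0, hm⟩ := P.exists_ker
      refine ⟨⟨m, P.mem_R_of_ker hm⟩, ?_, ?_⟩
      · rw [mem_nonZeroDivisors_iff_ne_zero]
        exact fun h => hm0 (congrArg Subtype.val h)
      · rintro x ⟨t, ht, rfl⟩
        refine ⟨⟨m * t, P.mem_R_of_ker (by rw [map_mul, hm, zero_mul])⟩, ?_⟩
        rw [Algebra.smul_def]
        exact map_mul (algebraMap T K) m t⟩

end

end PullbackSquarePlus

/-- The sequence `0 → A → B → C → 0` of (multiplicatively written) abelian groups is split exact. -/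
structure IsSplitShortExact {A B C : Type*} [CommGroup A] [CommGroup B] [CommGroup C]
    (α : A →* B) (β : B →* C) : Prop where
  injective : Function.Injective α
  exact : α.range = β.ker
  surjective : Function.Surjective β
  split : ∃ γ : B →* A, γ.comp α = MonoidHom.id A

open scoped nonZeroDivisors

/-! Write M for the kernel of `φ`; it is an ideal of both T and R, so MT = M ⊆ R.

Units of T. The hypothesis on units says that every nonzero fractional ideal J of D contains φ(u)
for some unit u of T (`exists_unit_mem`). So φ⁻¹(J) contains u, its inverse lies in u⁻¹R ⊆ T, and
that inverse can be computed modulo M. Hence φ⁻¹ commutes with inverses, products, v and t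
(`preimage_inv`, `preimage_mul`, `tOp_preimage`) and preserves principal ideals, which gives α.

Escaping M. An ideal whose t-closure contains 1 cannot lie in M, since D ≠ k (`exists_mem_not_ker`).
So a t-invertible H has h ∈ H and g ∈ H⁻¹ with a = hg outside M. As M + aT = T, membership of x in a
T-module may be tested on ax and Mx (`mem_of_ker_mul_mem`): the first test uses gH ⊆ R, the second
M(HT) ⊆ H. This gives β. For its surjectivity, scale E into T so that it contains some e ≡ 1 mod M;
then E ∩ R is t-invertible and generates E over T.

Kernel of β. If HT = T, some multiple uH by a unit u of T satisfies M ⊆ uH ⊆ R, so it is the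
preimage of its own image in k.

Splitting. Sending H to the class of φ(gH)ᵗ, for any g with gH ⊆ R and gH ⊄ M, is a homomorphism γ
with γα = id. It yields injectivity of α and the splitting at once. -/

namespace StarOperation

/-! ### Fractional ideals and star operations on one domain -/

section FractionalIdeal

variable {A K : Type*} [CommRing A] [Field K] [Algebra A K]

theorem ne_zero_of_mem {E : FractionalIdeal A⁰ K} {x : K} (hx : x ∈ E) (h0 : x ≠ 0) : E ≠ 0 := by
  rintro rfl
  exact h0 (FractionalIdeal.mem_zero_iff _ |>.1 hx)

theorem exists_mem_ne_zero {E : FractionalIdeal A⁰ K} (hE : E ≠ 0) : ∃ x ∈ E, x ≠ 0 := by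
  by_contra! h
  exact hE (FractionalIdeal.eq_zero_iff.2 h)

theorem ideal_add_mem {E : FractionalIdeal A⁰ K} {x y : K} (hx : x ∈ E) (hy : y ∈ E) :
    x + y ∈ E :=
  Submodule.add_mem (E : Submodule A K) hx hy

theorem ideal_mul_ne_zero {E F : FractionalIdeal A⁰ K} (hE : E ≠ 0) (hF : F ≠ 0) : E * F ≠ 0 := by
  obtain ⟨x, hx, hx0⟩ := exists_mem_ne_zero hE
  obtain ⟨y, hy, hy0⟩ := exists_mem_ne_zero hF
  exact ne_zero_of_mem (FractionalIdeal.mul_mem_mul hx hy) (mul_ne_zero hx0 hy0)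

end FractionalIdeal

section Basic

variable {A K : Type*} [CommRing A] [Field K] [Algebra A K] [IsFractionRing A K]

/-- Scaling and monotonicity in one step: multiplication by x passes to closures. Most estimates on
v- and t-closures below have this form. -/
theorem mul_mem_of_forall_mul_mem (s : StarOperation A K) {x y : K} {E F : FractionalIdeal A⁰ K}
    (h : ∀ e ∈ E, x * e ∈ F) (hy : y ∈ s E) : x * y ∈ s F :=
  s.mono _ _ (FractionalIdeal.spanSingleton_mul_le_iff.2 h) (s.smul_mem hy)

theorem star_eq_one_of_mem (s : StarOperation A K) {E : FractionalIdeal A⁰ K} (hE : E ≤ 1)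
    (h : (1 : K) ∈ s E) : s E = 1 := by
  refine le_antisymm ((s.mono _ _ hE).trans s.star_one.le) ?_
  rw [← FractionalIdeal.spanSingleton_one, FractionalIdeal.spanSingleton_le_iff_mem]
  exact h

theorem one_mem_of_star_eq_one (s : StarOperation A K) {E : FractionalIdeal A⁰ K}
    (h : s E = 1) : (1 : K) ∈ s E := by
  rw [h]
  exact FractionalIdeal.one_mem_one _

variable [IsDomain A]

theorem inv_ne_zero_of_ne_zero {E : FractionalIdeal A⁰ K} (hE : E ≠ 0) : E⁻¹ ≠ 0 := by
  intro h
  have := le_inv_inv E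
  rw [h, FractionalIdeal.inv_zero'] at this
  exact hE (le_antisymm this (FractionalIdeal.zero_le _))

theorem mem_vOp_iff {E : FractionalIdeal A⁰ K} (hE : E ≠ 0) {x : K} :
    x ∈ vOp A K E ↔ ∀ y : K, (∀ e ∈ E, y * e ∈ (1 : FractionalIdeal A⁰ K)) →
      x * y ∈ (1 : FractionalIdeal A⁰ K) := by
  rw [vOp_apply, FractionalIdeal.mem_inv_iff (inv_ne_zero_of_ne_zero hE)]
  simp only [FractionalIdeal.mem_inv_iff hE]

theorem mem_tOp_iff {E : FractionalIdeal A⁰ K} {x : K} : x ∈ tOp A K E ↔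
    ∃ F : FractionalIdeal A⁰ K, (F : Submodule A K).FG ∧ F ≤ E ∧ x ∈ vOp A K F := Iff.rfl

theorem tOp_le_vOp (E : FractionalIdeal A⁰ K) : tOp A K E ≤ vOp A K E := by
  rintro x ⟨F, -, hF, hx⟩
  exact (vOp A K).mono _ _ hF hx

theorem mul_mem_one_of_mem_inv {E : FractionalIdeal A⁰ K} {x y : K} (hx : x ∈ E) (hy : y ∈ E⁻¹) :
    x * y ∈ (1 : FractionalIdeal A⁰ K) :=
  InvGroup.mul_inv_le E (FractionalIdeal.mul_mem_mul hx hy)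

/-- Two elements of `Inv^s(A)` have the same class if they differ by a nonzero scalar. -/
theorem cl_eq_cl_of_smul (s : StarOperation A K) {I J : s.InvGroup} {x : K} (hx : x ≠ 0)
    (h : I.ideal = FractionalIdeal.spanSingleton A⁰ x * J.ideal) : s.cl I = s.cl J := by
  suffices hp : J⁻¹ * I ∈ s.prin from (QuotientGroup.eq.2 hp).symm
  refine ⟨x, hx, ?_⟩
  rw [InvGroup.ideal_mul, InvGroup.ideal_inv, h, mul_left_comm, s.star_smul _ _ hx,
    mul_comm J.ideal⁻¹]
  change _ * s (J.1 * J.1⁻¹) = _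
  rw [J.2.2, mul_one]

theorem InvGroup.star_ideal {s : StarOperation A K} (I : s.InvGroup) : s I.ideal = I.ideal := I.2.1

theorem InvGroup.star_ideal_mul_inv {s : StarOperation A K} (I : s.InvGroup) :
    s (I.ideal * I.ideal⁻¹) = 1 := I.2.2

theorem InvGroup.ideal_ne_zero {s : StarOperation A K} (I : s.InvGroup) : I.ideal ≠ 0 :=
  InvGroup.ne_zero_of_star I.2.2

theorem star_mul_mul_inv (s : StarOperation A K) {I J : FractionalIdeal A⁰ K}
    (hI : s (I * I⁻¹) = 1) (hJ : s (J * J⁻¹) = 1) : s (I * J * (I * J)⁻¹) = 1 := by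
  apply InvGroup.star_mul_inv_of_mul (J := I⁻¹ * J⁻¹)
  rw [mul_mul_mul_comm, ← s.star_mul_left, hI, one_mul, hJ]

theorem star_mul_inv_smul (s : StarOperation A K) {I : FractionalIdeal A⁰ K} {x : K} (hx : x ≠ 0)
    (h : s (I * I⁻¹) = 1) : s ((FractionalIdeal.spanSingleton A⁰ x * I) *
      (FractionalIdeal.spanSingleton A⁰ x * I)⁻¹) = 1 := by
  apply InvGroup.star_mul_inv_of_mul (J := FractionalIdeal.spanSingleton A⁰ x⁻¹ * I⁻¹)
  rw [mul_mul_mul_comm, FractionalIdeal.spanSingleton_mul_spanSingleton, mul_inv_cancel₀ hx,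
    FractionalIdeal.spanSingleton_one, one_mul, h]

/-- The multiple `x I` of an `s`-invertible `s`-ideal `I`. -/
def InvGroup.smul {s : StarOperation A K} (x : K) (hx : x ≠ 0) (I : s.InvGroup) : s.InvGroup :=
  ⟨FractionalIdeal.spanSingleton A⁰ x * I.ideal, by rw [s.star_smul x _ hx, I.star_ideal],
    s.star_mul_inv_smul hx I.star_ideal_mul_inv⟩

theorem InvGroup.ideal_smul {s : StarOperation A K} (x : K) (hx : x ≠ 0) (I : s.InvGroup) :
    (InvGroup.smul x hx I).ideal = FractionalIdeal.spanSingleton A⁰ x * I.ideal := rfl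

end Basic

/-! ### Extension of fractional ideals from R to T -/

section Overring

variable {R K : Type*} (T : Type*) [CommRing R] [CommRing T] [Field K] [Algebra R T]
    [Algebra R K] [Algebra T K] [IsScalarTower R T K] [IsFractionRing R K] [IsFractionRing T K]

theorem mem_extendIdeal {H : FractionalIdeal R⁰ K} {x : K} (hx : x ∈ H) : x ∈ extendIdeal T H :=
  Submodule.subset_span hx

theorem extendIdeal_le {H : FractionalIdeal R⁰ K} {E : FractionalIdeal T⁰ K}
    (h : ∀ x ∈ H, x ∈ E) : extendIdeal T H ≤ E := by
  have : Submodule.span T {x | x ∈ H} ≤ (E : Submodule T K) := Submodule.span_le.2 h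
  exact this

theorem extendIdeal_one : extendIdeal T (1 : FractionalIdeal R⁰ K) = 1 := by
  apply le_antisymm
  · apply extendIdeal_le
    intro x hx
    obtain ⟨r, rfl⟩ := (FractionalIdeal.mem_one_iff _).1 hx
    exact (FractionalIdeal.mem_one_iff _).2 ⟨algebraMap R T r,
      (IsScalarTower.algebraMap_apply R T K r).symm⟩
  · rw [← FractionalIdeal.spanSingleton_one, FractionalIdeal.spanSingleton_le_iff_mem]
    exact mem_extendIdeal T (FractionalIdeal.one_mem_one _)

variable {T} in
theorem mul_mem_of_mem_extendIdeal {H : FractionalIdeal R⁰ K} {E : FractionalIdeal T⁰ K} {x : K}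
    (h : ∀ y ∈ H, x * y ∈ E) {z : K} (hz : z ∈ extendIdeal T H) : x * z ∈ E := by
  replace hz : z ∈ Submodule.span T {x | x ∈ H} := hz
  induction hz using Submodule.span_induction with
  | mem z hz => exact h z hz
  | zero =>
    rw [mul_zero]
    exact Submodule.zero_mem (E : Submodule T K)
  | add a b _ _ ha hb =>
    rw [mul_add]
    exact ideal_add_mem ha hb
  | smul t a _ ha =>
    rw [mul_smul_comm]
    exact Submodule.smul_mem (E : Submodule T K) t ha

theorem extendIdeal_smul (x : K) (H : FractionalIdeal R⁰ K) :
    extendIdeal T (FractionalIdeal.spanSingleton R⁰ x * H) =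
      FractionalIdeal.spanSingleton T⁰ x * extendIdeal T H := by
  apply le_antisymm
  · apply extendIdeal_le
    intro y hy
    obtain ⟨z, hz, rfl⟩ := FractionalIdeal.mem_singleton_mul.1 hy
    exact FractionalIdeal.mul_mem_mul (FractionalIdeal.mem_spanSingleton_self _ _)
      (mem_extendIdeal T hz)
  · rw [FractionalIdeal.spanSingleton_mul_le_iff]
    exact fun z hz => mul_mem_of_mem_extendIdeal (fun y hy => mem_extendIdeal T
      (FractionalIdeal.mul_mem_mul (FractionalIdeal.mem_spanSingleton_self _ _) hy)) hz

theorem extendIdeal_spanSingleton (x : K) :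
    extendIdeal T (FractionalIdeal.spanSingleton R⁰ x) = FractionalIdeal.spanSingleton T⁰ x := by
  rw [← mul_one (FractionalIdeal.spanSingleton R⁰ x), extendIdeal_smul, extendIdeal_one, mul_one]

variable {T} in
theorem extendIdeal_mul_le (H H' : FractionalIdeal R⁰ K) {E : FractionalIdeal T⁰ K}
    (h : ∀ x ∈ H, ∀ y ∈ H', x * y ∈ E) : extendIdeal T H * extendIdeal T H' ≤ E := by
  rw [FractionalIdeal.mul_le]
  intro x hx y hy
  refine mul_mem_of_mem_extendIdeal (fun z hz => ?_) hy
  rw [mul_comm]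
  refine mul_mem_of_mem_extendIdeal (fun w hw => ?_) hx
  rw [mul_comm]
  exact h w hw z hz

variable {T} in
theorem mem_restrictIdeal [IsDomain R] [IsDomain T] (hc : ConductorNeZero R T)
    {E : FractionalIdeal T⁰ K} {x : K} :
    x ∈ restrictIdeal hc E ↔ x ∈ E := Iff.rfl

end Overring

end StarOperation

/-! ### Units of T and the ideal M in the pullback -/

namespace PullbackSquarePlus

open StarOperation

variable {T k : Type*} [CommRing T] [Field k] (P : PullbackSquarePlus T k)

theorem mem_one_iff_mem_D {z : k} : z ∈ (1 : FractionalIdeal P.D⁰ k) ↔ z ∈ P.D := by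
  rw [FractionalIdeal.mem_one_iff]
  exact ⟨fun ⟨d, hd⟩ => hd ▸ d.2, fun h => ⟨⟨z, h⟩, rfl⟩⟩

theorem D_smul_mem {J : FractionalIdeal P.D⁰ k} {d z : k} (hd : d ∈ P.D) (hz : z ∈ J) :
    d * z ∈ J :=
  Submodule.smul_mem (J : Submodule P.D k) (⟨d, hd⟩ : P.D) hz

theorem exists_unit (hU : Function.Surjective P.unitsMap) {z : k} (hz : z ≠ 0) :
    ∃ (u : Tˣ) (d : P.Dˣ), P.φ u = z * (d : P.D) := by
  obtain ⟨u, hu⟩ := hU (QuotientGroup.mk (Units.mk0 z hz))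
  obtain ⟨d, hd⟩ := QuotientGroup.eq.1 hu.symm
  refine ⟨u, d, ?_⟩
  have := congrArg Units.val (eq_inv_mul_iff_mul_eq.1 hd)
  exact this.symm

/-- Every nonzero fractional ideal of `D` contains the image of a unit of `T`. -/
theorem exists_unit_mem (hU : Function.Surjective P.unitsMap) {J : FractionalIdeal P.D⁰ k}
    (hJ : J ≠ 0) : ∃ u : Tˣ, P.φ u ∈ J := by
  obtain ⟨z, hz, hz0⟩ := exists_mem_ne_zero hJ
  obtain ⟨u, d, hu⟩ := P.exists_unit hU hz0
  refine ⟨u, ?_⟩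
  rw [hu, mul_comm]
  exact P.D_smul_mem (d : P.D).2 hz

theorem exists_sub_mul_mem_ker {a : T} (ha : P.φ a ≠ 0) : ∃ t : T, P.φ (1 - a * t) = 0 := by
  obtain ⟨t, ht⟩ := P.surjective (P.φ a)⁻¹
  exact ⟨t, by rw [map_sub, map_one, map_mul, ht, mul_inv_cancel₀ ha, sub_self]⟩

variable {K : Type*} [Field K] [Algebra T K]

/-- Since `M + a T = T` for `a ∉ M`, a `T`-submodule of `K` contains `x` once it contains `M x`
and `a x`. -/
theorem mem_of_ker_mul_mem {N : Submodule T K} {x : K} {a : T} (ha : P.φ a ≠ 0)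
    (hax : algebraMap T K a * x ∈ N) (hx : ∀ m : T, P.φ m = 0 → algebraMap T K m * x ∈ N) :
    x ∈ N := by
  obtain ⟨t, ht⟩ := P.exists_sub_mul_mem_ker ha
  have h := N.add_mem (hx _ ht) (N.smul_mem t hax)
  rw [Algebra.smul_def, ← mul_assoc, ← map_mul, ← add_mul, ← map_add, mul_comm t,
    sub_add_cancel, map_one, one_mul] at h
  exact h

theorem mem_one_R_iff {x : K} : x ∈ (1 : FractionalIdeal P.R⁰ K) ↔
    ∃ t : T, P.φ t ∈ P.D ∧ algebraMap T K t = x := by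
  rw [FractionalIdeal.mem_one_iff]
  exact ⟨fun ⟨r, hr⟩ => ⟨r, r.2, hr⟩, fun ⟨t, ht, h⟩ => ⟨⟨t, ht⟩, h⟩⟩

theorem algebraMap_mul_mem {H : FractionalIdeal P.R⁰ K} {t : T} (ht : P.φ t ∈ P.D) {x : K}
    (hx : x ∈ H) : algebraMap T K t * x ∈ H := by
  have h := Submodule.smul_mem (H : Submodule P.R K) (⟨t, ht⟩ : P.R) hx
  rw [Algebra.smul_def] at h
  exact h

section

variable [IsFractionRing T K]

theorem algebraMap_mem_one_R_iff {t : T} :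
    algebraMap T K t ∈ (1 : FractionalIdeal P.R⁰ K) ↔ P.φ t ∈ P.D := by
  rw [mem_one_R_iff]
  constructor
  · rintro ⟨s, hs, h⟩
    rwa [← IsFractionRing.injective T K h]
  · exact fun h => ⟨t, h, rfl⟩

theorem algebraMap_mem_one_of_ker {m : T} (hm : P.φ m = 0) :
    algebraMap T K m ∈ (1 : FractionalIdeal P.R⁰ K) :=
  P.algebraMap_mem_one_R_iff.2 (hm ▸ P.D.zero_mem)

theorem ne_zero_of_map {t : T} (ht : P.φ t ≠ 0) : algebraMap T K t ≠ 0 :=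
  (map_ne_zero_iff _ (IsFractionRing.injective T K)).2 fun h => ht (by rw [h, map_zero])

end

/-! ### Ideals of D and ideals of R: preimage and image under φ -/

variable [IsDomain T]

theorem mem_preimage {J : FractionalIdeal P.D⁰ k} {x : K} :
    x ∈ P.preimage K J ↔ ∃ t : T, P.φ t ∈ J ∧ algebraMap T K t = x := Iff.rfl

theorem preimage_mul_le (J J' : FractionalIdeal P.D⁰ k) :
    P.preimage K J * P.preimage K J' ≤ P.preimage K (J * J') := by
  rw [FractionalIdeal.mul_le]
  rintro _ ⟨t, ht, rfl⟩ _ ⟨s, hs, rfl⟩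
  exact ⟨t * s, by rw [map_mul]; exact FractionalIdeal.mul_mem_mul ht hs, map_mul _ _ _⟩

theorem preimage_one : P.preimage K 1 = 1 := by
  ext x
  rw [mem_preimage, mem_one_R_iff]
  simp only [mem_one_iff_mem_D]

variable [IsFractionRing T K]

theorem algebraMap_mem_preimage {J : FractionalIdeal P.D⁰ k} {t : T} :
    algebraMap T K t ∈ P.preimage K J ↔ P.φ t ∈ J := by
  constructor
  · rintro ⟨s, hs, h⟩
    rwa [← IsFractionRing.injective T K h]
  · exact fun h => ⟨t, h, rfl⟩

theorem algebraMap_mem_preimage_of_ker {J : FractionalIdeal P.D⁰ k} {m : T} (hm : P.φ m = 0) :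
    algebraMap T K m ∈ P.preimage K J :=
  P.algebraMap_mem_preimage.2 (hm ▸ Submodule.zero_mem (J : Submodule P.D k))

/-- As φ is surjective, no information is lost on taking preimages, so identities between ideals of
D can be checked in R. -/
theorem preimage_le_iff {J J' : FractionalIdeal P.D⁰ k} :
    P.preimage K J ≤ P.preimage K J' ↔ J ≤ J' := by
  constructor
  · intro h z hz
    obtain ⟨t, rfl⟩ := P.surjective z
    exact P.algebraMap_mem_preimage.1 (h (P.algebraMap_mem_preimage (K := K).2 hz))
  · rintro h x ⟨t, ht, rfl⟩
    exact ⟨t, h ht, rfl⟩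

theorem preimage_injective {J J' : FractionalIdeal P.D⁰ k}
    (h : P.preimage K J = P.preimage K J') : J = J' :=
  le_antisymm (P.preimage_le_iff.1 h.le) (P.preimage_le_iff.1 h.ge)

/-- The image in `k` of `H ∩ R`, a fractional ideal of `D`. -/
def image (H : FractionalIdeal P.R⁰ K) : FractionalIdeal P.D⁰ k :=
  ⟨{  carrier := {z | ∃ t : T, P.φ t ∈ P.D ∧ algebraMap T K t ∈ H ∧ P.φ t = z}
      zero_mem' := ⟨0, by rw [map_zero]; exact P.D.zero_mem, by
        rw [map_zero]
        exact Submodule.zero_mem (H : Submodule P.R K), map_zero _⟩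
      add_mem' := by
        rintro x y ⟨t, ht, ht', rfl⟩ ⟨u, hu, hu', rfl⟩
        refine ⟨t + u, ?_, ?_, map_add _ _ _⟩
        · rw [map_add]
          exact P.D.add_mem ht hu
        · rw [map_add]
          exact Submodule.add_mem (H : Submodule P.R K) ht' hu'
      smul_mem' := by
        rintro ⟨d, hd⟩ x ⟨t, ht, ht', rfl⟩
        obtain ⟨r, rfl⟩ := P.surjective d
        refine ⟨r * t, ?_, ?_, map_mul _ _ _⟩
        · rw [map_mul]
          exact P.D.mul_mem hd ht
        · rw [map_mul]
          exact P.algebraMap_mul_mem hd ht' },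
    1, one_mem _, by
      rintro x ⟨t, ht, -, rfl⟩
      exact ⟨⟨P.φ t, ht⟩, by rw [one_smul]; rfl⟩⟩

theorem image_mem {H : FractionalIdeal P.R⁰ K} (hH : H ≤ 1) {t : T} (ht : algebraMap T K t ∈ H) :
    P.φ t ∈ P.image H :=
  ⟨t, P.algebraMap_mem_one_R_iff.1 (hH ht), ht, rfl⟩

/-- Together with `image_le`, this makes `image` left adjoint to `preimage` on the fractional ideals
contained in R. -/
theorem le_preimage_image {H : FractionalIdeal P.R⁰ K} (hH : H ≤ 1) :
    H ≤ P.preimage K (P.image H) := by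
  intro x hx
  obtain ⟨t, -, rfl⟩ := P.mem_one_R_iff.1 (hH hx)
  exact ⟨t, P.image_mem hH hx, rfl⟩

theorem image_le {H : FractionalIdeal P.R⁰ K} {J : FractionalIdeal P.D⁰ k}
    (h : H ≤ P.preimage K J) : P.image H ≤ J := by
  rintro _ ⟨t, -, ht, rfl⟩
  exact P.algebraMap_mem_preimage.1 (h ht)

theorem image_preimage {J : FractionalIdeal P.D⁰ k} (hJ : J ≤ 1) :
    P.image (P.preimage K J) = J := by
  apply le_antisymm (P.image_le le_rfl)
  intro z hz
  obtain ⟨t, rfl⟩ := P.surjective z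
  exact ⟨t, P.mem_one_iff_mem_D.1 (hJ hz), ⟨t, hz, rfl⟩, rfl⟩

theorem image_mul {H H' : FractionalIdeal P.R⁰ K} (hH : H ≤ 1) (hH' : H' ≤ 1) :
    P.image (H * H') = P.image H * P.image H' := by
  apply le_antisymm
  · apply P.image_le
    exact (mul_le_mul' (P.le_preimage_image hH) (P.le_preimage_image hH')).trans
      (P.preimage_mul_le _ _)
  · rw [FractionalIdeal.mul_le]
    rintro _ ⟨t, ht, ht', rfl⟩ _ ⟨s, hs, hs', rfl⟩
    refine ⟨t * s, ?_, ?_, map_mul _ _ _⟩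
    · rw [map_mul]
      exact P.D.mul_mem ht hs
    · rw [map_mul]
      exact FractionalIdeal.mul_mem_mul ht' hs'

/-- `M` is a `t`-ideal of `R`. -/
theorem exists_mem_not_ker {B : FractionalIdeal P.R⁰ K} (h : (1 : K) ∈ tOp P.R K B) :
    ∃ x ∈ B, ∀ t : T, algebraMap T K t = x → P.φ t ≠ 0 := by
  by_contra! hB
  obtain ⟨F, -, hFB, hF⟩ := mem_tOp_iff.1 h
  have hF0 : F ≠ 0 := by
    rintro rfl
    rw [StarOperation.star_zero, FractionalIdeal.mem_zero_iff] at hF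
    exact one_ne_zero hF
  -- If B ⊆ M, then F ⊆ M, so TF ⊆ M ⊆ R; from 1 ∈ Fᵛ it would follow that T ⊆ R, that is D = k.
  apply P.D_ne_top
  rw [eq_top_iff]
  rintro z -
  obtain ⟨t, rfl⟩ := P.surjective z
  rw [← P.algebraMap_mem_one_R_iff (K := K), ← one_mul (algebraMap T K t)]
  refine (mem_vOp_iff hF0).1 hF _ fun e he => ?_
  obtain ⟨m, rfl, hm⟩ := hB e (hFB he)
  rw [← map_mul]
  exact P.algebraMap_mem_one_of_ker (by rw [map_mul, hm, mul_zero])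

/-! ### Preimages commute with inverses, v, t and products -/

theorem exists_fg_le_preimage {F : FractionalIdeal P.R⁰ K} {J : FractionalIdeal P.D⁰ k}
    (hF : (F : Submodule P.R K).FG) (h : F ≤ P.preimage K J) :
    ∃ G : FractionalIdeal P.D⁰ k, (G : Submodule P.D k).FG ∧ G ≤ J ∧ F ≤ P.preimage K G := by
  suffices H : ∀ N : Submodule P.R K, N.FG → (∀ y ∈ N, y ∈ P.preimage K J) →
      ∃ G : FractionalIdeal P.D⁰ k, (G : Submodule P.D k).FG ∧ G ≤ J ∧
        ∀ y ∈ N, y ∈ P.preimage K G from H F hF fun y hy => h hy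
  intro N hN
  induction N, hN using Submodule.fg_induction with
  | singleton y =>
    intro hy
    obtain ⟨t, ht, rfl⟩ := hy y (Submodule.mem_span_singleton_self y)
    refine ⟨FractionalIdeal.spanSingleton P.D⁰ (P.φ t), ?_,
      FractionalIdeal.spanSingleton_le_iff_mem.2 ht, ?_⟩
    · rw [FractionalIdeal.coe_spanSingleton]
      exact Submodule.fg_span_singleton _
    · intro z hz
      obtain ⟨r, rfl⟩ := Submodule.mem_span_singleton.1 hz
      rw [Algebra.smul_def]
      exact P.algebraMap_mul_mem r.2
        (P.algebraMap_mem_preimage.2 (FractionalIdeal.mem_spanSingleton_self _ _))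
  | sup N₁ N₂ _ _ ih₁ ih₂ =>
    intro h
    obtain ⟨G₁, hG₁, hGJ₁, hy₁⟩ := ih₁ fun y hy => h y (Submodule.mem_sup_left hy)
    obtain ⟨G₂, hG₂, hGJ₂, hy₂⟩ := ih₂ fun y hy => h y (Submodule.mem_sup_right hy)
    refine ⟨G₁ ⊔ G₂, ?_, sup_le hGJ₁ hGJ₂, ?_⟩
    · rw [FractionalIdeal.coe_sup]
      exact hG₁.sup hG₂
    · intro y hy
      obtain ⟨a, ha, b, hb, rfl⟩ := Submodule.mem_sup.1 hy
      exact Submodule.add_mem (P.preimage K (G₁ ⊔ G₂) : Submodule P.R K)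
        (P.preimage_le_iff.2 le_sup_left (hy₁ a ha)) (P.preimage_le_iff.2 le_sup_right (hy₂ b hb))

-- F is generated by lifts of generators of G. It maps onto G but need not contain M, so it may be
-- smaller than φ⁻¹(G).
variable (K) in
theorem exists_fg_lift {G : FractionalIdeal P.D⁰ k} (hG : (G : Submodule P.D k).FG) :
    ∃ F : FractionalIdeal P.R⁰ K, (F : Submodule P.R K).FG ∧ F ≤ P.preimage K G ∧
      ∀ z ∈ G, ∃ t : T, algebraMap T K t ∈ F ∧ P.φ t = z := by
  suffices H : ∀ N : Submodule P.D k, N.FG → (∀ z ∈ N, z ∈ G) →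
      ∃ F : FractionalIdeal P.R⁰ K, (F : Submodule P.R K).FG ∧ F ≤ P.preimage K G ∧
      ∀ z ∈ N, ∃ t : T, algebraMap T K t ∈ F ∧ P.φ t = z from H G hG fun z hz => hz
  intro N hN
  induction N, hN using Submodule.fg_induction with
  | singleton z =>
    intro hz
    obtain ⟨t, rfl⟩ := P.surjective z
    refine ⟨FractionalIdeal.spanSingleton P.R⁰ (algebraMap T K t), ?_,
      FractionalIdeal.spanSingleton_le_iff_mem.2
        (P.algebraMap_mem_preimage.2 (hz _ (Submodule.mem_span_singleton_self _))), ?_⟩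
    · rw [FractionalIdeal.coe_spanSingleton]
      exact Submodule.fg_span_singleton _
    · intro z hz
      obtain ⟨⟨d, hd⟩, rfl⟩ := Submodule.mem_span_singleton.1 hz
      obtain ⟨r, rfl⟩ := P.surjective d
      refine ⟨r * t, ?_, map_mul _ _ _⟩
      rw [map_mul]
      exact P.algebraMap_mul_mem hd (FractionalIdeal.mem_spanSingleton_self _ _)
  | sup N₁ N₂ _ _ ih₁ ih₂ =>
    intro h
    obtain ⟨F₁, hF₁, hFG₁, hz₁⟩ := ih₁ fun y hy => h y (Submodule.mem_sup_left hy)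
    obtain ⟨F₂, hF₂, hFG₂, hz₂⟩ := ih₂ fun y hy => h y (Submodule.mem_sup_right hy)
    refine ⟨F₁ ⊔ F₂, ?_, sup_le hFG₁ hFG₂, ?_⟩
    · rw [FractionalIdeal.coe_sup]
      exact hF₁.sup hF₂
    · intro y hy
      obtain ⟨a, ha, b, hb, rfl⟩ := Submodule.mem_sup.1 hy
      obtain ⟨t₁, ht₁, rfl⟩ := hz₁ a ha
      obtain ⟨t₂, ht₂, rfl⟩ := hz₂ b hb
      refine ⟨t₁ + t₂, ?_, map_add _ _ _⟩
      rw [map_add]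
      exact ideal_add_mem ((le_sup_left : F₁ ≤ F₁ ⊔ F₂) ht₁) ((le_sup_right : F₂ ≤ F₁ ⊔ F₂) ht₂)

/-- Because F contains a unit u of T, F⁻¹ ⊆ u⁻¹R ⊆ T; for x in T, the condition xF ⊆ R depends only
on φ(x) and on the image G of F. Asking F only to map onto G covers both φ⁻¹(G) and its finitely
generated lifts. -/
theorem inv_eq_preimage_inv {F : FractionalIdeal P.R⁰ K} {G : FractionalIdeal P.D⁰ k}
    (hFG : F ≤ P.preimage K G) (hGF : ∀ z ∈ G, ∃ t : T, algebraMap T K t ∈ F ∧ P.φ t = z)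
    {u : T} (hu : IsUnit u) (huF : algebraMap T K u ∈ F) : F⁻¹ = P.preimage K G⁻¹ := by
  have hF : F ≠ 0 := ne_zero_of_mem huF
    ((map_ne_zero_iff _ (IsFractionRing.injective T K)).2 hu.ne_zero)
  have hG : G ≠ 0 := ne_zero_of_mem (P.algebraMap_mem_preimage.1 (hFG huF)) (hu.map P.φ).ne_zero
  ext x
  rw [FractionalIdeal.mem_inv_iff hF]
  constructor
  · intro h
    obtain ⟨t, -, ht⟩ := P.mem_one_R_iff.1 (h _ huF)
    obtain ⟨u, rfl⟩ := hu
    have hx : x = algebraMap T K (t * (u⁻¹ : Tˣ)) := by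
      rw [map_mul, ht, mul_assoc, ← map_mul, Units.mul_inv, map_one, mul_one]
    refine ⟨_, ?_, hx.symm⟩
    rw [FractionalIdeal.mem_inv_iff hG]
    intro z hz
    obtain ⟨s, hs, rfl⟩ := hGF z hz
    have := h _ hs
    rwa [hx, ← map_mul, P.algebraMap_mem_one_R_iff, ← P.mem_one_iff_mem_D, map_mul] at this
  · rintro ⟨t, ht, rfl⟩ y hy
    obtain ⟨s, hs, rfl⟩ := hFG hy
    rw [← map_mul, P.algebraMap_mem_one_R_iff, ← P.mem_one_iff_mem_D, map_mul]
    exact (FractionalIdeal.mem_inv_iff hG).1 ht _ hs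

theorem preimage_inv (hU : Function.Surjective P.unitsMap) {J : FractionalIdeal P.D⁰ k}
    (hJ : J ≠ 0) : (P.preimage K J)⁻¹ = P.preimage K J⁻¹ := by
  obtain ⟨u, hu⟩ := P.exists_unit_mem hU hJ
  refine P.inv_eq_preimage_inv le_rfl (fun z hz => ?_) u.isUnit (P.algebraMap_mem_preimage.2 hu)
  obtain ⟨t, rfl⟩ := P.surjective z
  exact ⟨t, P.algebraMap_mem_preimage.2 hz, rfl⟩

theorem vOp_preimage (hU : Function.Surjective P.unitsMap) {J : FractionalIdeal P.D⁰ k}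
    (hJ : J ≠ 0) : vOp P.R K (P.preimage K J) = P.preimage K (vOp P.D k J) := by
  rw [vOp_apply, P.preimage_inv hU hJ, P.preimage_inv hU (inv_ne_zero_of_ne_zero hJ), vOp_apply]

/-- The ideal generated by the images may vanish, when F ⊆ M; a nonzero element of J is adjoined
because the description of v needs a nonzero ideal. -/
theorem exists_fg_le_preimage_ne_zero {F : FractionalIdeal P.R⁰ K} {J : FractionalIdeal P.D⁰ k}
    (hJ : J ≠ 0) (hF : (F : Submodule P.R K).FG) (h : F ≤ P.preimage K J) :
    ∃ G : FractionalIdeal P.D⁰ k, (G : Submodule P.D k).FG ∧ G ≠ 0 ∧ G ≤ J ∧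
      F ≤ P.preimage K G := by
  obtain ⟨G, hG, hGJ, hFG⟩ := P.exists_fg_le_preimage hF h
  obtain ⟨z, hz, hz0⟩ := exists_mem_ne_zero hJ
  refine ⟨G ⊔ FractionalIdeal.spanSingleton P.D⁰ z, ?_, ?_,
    sup_le hGJ (FractionalIdeal.spanSingleton_le_iff_mem.2 hz),
    hFG.trans (P.preimage_le_iff.2 le_sup_left)⟩
  · rw [FractionalIdeal.coe_sup, FractionalIdeal.coe_spanSingleton]
    exact hG.sup (Submodule.fg_span_singleton _)
  · exact ne_zero_of_mem ((le_sup_right : _ ≤ G ⊔ _)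
      (FractionalIdeal.mem_spanSingleton_self P.D⁰ z)) hz0

theorem tOp_preimage (hU : Function.Surjective P.unitsMap) {J : FractionalIdeal P.D⁰ k}
    (hJ : J ≠ 0) : tOp P.R K (P.preimage K J) = P.preimage K (tOp P.D k J) := by
  apply le_antisymm
  · intro x hx
    obtain ⟨F, hF, hFJ, hx⟩ := mem_tOp_iff.1 hx
    obtain ⟨G, hG, hG0, hGJ, hFG⟩ := P.exists_fg_le_preimage_ne_zero hJ hF hFJ
    have hx' := (vOp P.R K).mono _ _ hFG hx
    rw [P.vOp_preimage hU hG0] at hx'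
    obtain ⟨t, ht, rfl⟩ := hx'
    exact ⟨t, mem_tOp_iff.2 ⟨G, hG, hGJ, ht⟩, rfl⟩
  · rintro _ ⟨t, ht, rfl⟩
    obtain ⟨G, hG, hGJ, ht⟩ := mem_tOp_iff.1 ht
    -- For G = 0 the element lies in M, which is contained in every preimage.
    by_cases hG0 : G = 0
    · rw [hG0, StarOperation.star_zero, FractionalIdeal.mem_zero_iff] at ht
      exact (tOp P.R K).le_self _ (P.algebraMap_mem_preimage_of_ker ht)
    obtain ⟨F, hF, hFG, hGF⟩ := P.exists_fg_lift K hG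
    obtain ⟨u, hu⟩ := P.exists_unit_mem hU hG0
    -- Adjoining u forces the inverse of F' into T, so that F'ᵛ = φ⁻¹(Gᵛ) although F' is only a
    -- finitely generated part of φ⁻¹(G).
    let F' := F ⊔ FractionalIdeal.spanSingleton P.R⁰ (algebraMap T K u)
    have huF : algebraMap T K u ∈ F' :=
      (le_sup_right : _ ≤ F') (FractionalIdeal.mem_spanSingleton_self _ _)
    have hFG' : F' ≤ P.preimage K G :=
      sup_le hFG (FractionalIdeal.spanSingleton_le_iff_mem.2 (P.algebraMap_mem_preimage.2 hu))
    refine mem_tOp_iff.2 ⟨F', ?_, hFG'.trans (P.preimage_le_iff.2 hGJ), ?_⟩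
    · rw [FractionalIdeal.coe_sup, FractionalIdeal.coe_spanSingleton]
      exact hF.sup (Submodule.fg_span_singleton _)
    · rw [vOp_apply, P.inv_eq_preimage_inv hFG' (fun z hz => ?_) u.isUnit huF,
        P.preimage_inv hU (inv_ne_zero_of_ne_zero hG0)]
      · exact ⟨t, ht, rfl⟩
      · obtain ⟨s, hs, h⟩ := hGF z hz
        exact ⟨s, (le_sup_left : F ≤ F') hs, h⟩

/-- The product on the right contains M, since m = u(u⁻¹m) with u ∈ φ⁻¹(J) and u⁻¹m ∈ M. So it is
enough to lift each element of JJ' to some element of the product. -/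
theorem preimage_mul (hU : Function.Surjective P.unitsMap) {J : FractionalIdeal P.D⁰ k}
    (hJ : J ≠ 0) (J' : FractionalIdeal P.D⁰ k) :
    P.preimage K (J * J') = P.preimage K J * P.preimage K J' := by
  refine le_antisymm ?_ (P.preimage_mul_le J J')
  obtain ⟨u, hu⟩ := P.exists_unit_mem hU hJ
  suffices H : ∀ z ∈ J * J', ∃ t : T, algebraMap T K t ∈ P.preimage K J * P.preimage K J' ∧
      P.φ t = z by
    rintro _ ⟨t, ht, rfl⟩
    obtain ⟨s, hs, h⟩ := H _ ht
    have h1 : P.φ ((u⁻¹ : Tˣ) * (t - s)) = 0 := by rw [map_mul, map_sub, h, sub_self, mul_zero]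
    have h2 := FractionalIdeal.mul_mem_mul (P.algebraMap_mem_preimage (K := K).2 hu)
      (P.algebraMap_mem_preimage_of_ker (K := K) (J := J') h1)
    rw [← map_mul, Units.mul_inv_cancel_left] at h2
    have h3 := ideal_add_mem h2 hs
    rwa [← map_add, sub_add_cancel] at h3
  intro z hz
  refine FractionalIdeal.mul_induction_on hz (fun i hi j hj => ?_) (fun x y hx hy => ?_)
  · obtain ⟨t, rfl⟩ := P.surjective i
    obtain ⟨s, rfl⟩ := P.surjective j
    refine ⟨t * s, ?_, map_mul _ _ _⟩
    rw [map_mul]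
    exact FractionalIdeal.mul_mem_mul (P.algebraMap_mem_preimage.2 hi)
      (P.algebraMap_mem_preimage.2 hj)
  · obtain ⟨t, ht, rfl⟩ := hx
    obtain ⟨s, hs, rfl⟩ := hy
    refine ⟨t + s, ?_, map_add _ _ _⟩
    rw [map_add]
    exact ideal_add_mem ht hs

/-- If φ(t) ∈ φ(u)D, then φ(u⁻¹t) ∈ D, so t ∈ uR. The unit d of D does not change the ideal; it
matches the generator as `exists_unit` supplies it. -/
theorem preimage_spanSingleton (u : Tˣ) (d : P.Dˣ) :
    P.preimage K (FractionalIdeal.spanSingleton P.D⁰ (P.φ u * (d : P.D))) =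
      FractionalIdeal.spanSingleton P.R⁰ (algebraMap T K u) := by
  apply le_antisymm
  · rintro _ ⟨t, ht, rfl⟩
    obtain ⟨c, hc⟩ := (FractionalIdeal.mem_spanSingleton _).1 ht
    have h : P.φ ((u⁻¹ : Tˣ) * t) = c * (d : P.D) := by
      have h1 : P.φ ((u⁻¹ : Tˣ) : T) * P.φ u = 1 := by rw [← map_mul, Units.inv_mul, map_one]
      rw [map_mul, ← hc, Algebra.smul_def, mul_left_comm, ← mul_assoc (P.φ _), h1, one_mul]
      rfl
    have h2 := P.algebraMap_mul_mem (h ▸ P.D.mul_mem c.2 (d : P.D).2)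
      (FractionalIdeal.mem_spanSingleton_self P.R⁰ (algebraMap T K u))
    rwa [← map_mul, mul_right_comm, Units.inv_mul, one_mul] at h2
  · rw [FractionalIdeal.spanSingleton_le_iff_mem, P.algebraMap_mem_preimage]
    refine (FractionalIdeal.mem_spanSingleton _).2 ⟨(d⁻¹ : P.Dˣ), ?_⟩
    have h1 : (((d⁻¹ : P.Dˣ) : P.D) : k) * ((d : P.D) : k) = 1 :=
      congrArg Subtype.val (Units.inv_mul d)
    change (((d⁻¹ : P.Dˣ) : P.D) : k) * _ = _
    rw [mul_left_comm, h1, mul_one]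

end PullbackSquarePlus

/-! ### The homomorphism α -/

namespace PullbackSquarePlus

open StarOperation

variable {T k : Type*} [CommRing T] [Field k] (P : PullbackSquarePlus T k)
variable {K : Type*} [Field K] [Algebra T K]

theorem algebraMap_mem_one_T (t : T) : algebraMap T K t ∈ (1 : FractionalIdeal T⁰ K) :=
  (FractionalIdeal.mem_one_iff _).2 ⟨t, rfl⟩

theorem one_T_mul_mem {E : FractionalIdeal T⁰ K} {x y : K} (hx : x ∈ (1 : FractionalIdeal T⁰ K))
    (hy : y ∈ E) : x * y ∈ E := by
  rw [← one_mul E]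
  exact FractionalIdeal.mul_mem_mul hx hy

theorem mem_one_T_of_mem_one_R {x : K} (hx : x ∈ (1 : FractionalIdeal P.R⁰ K)) :
    x ∈ (1 : FractionalIdeal T⁰ K) := by
  obtain ⟨t, -, rfl⟩ := P.mem_one_R_iff.1 hx
  exact algebraMap_mem_one_T t

variable [IsDomain T] [IsFractionRing T K]

theorem preimage_tOp_eq_self (hU : Function.Surjective P.unitsMap)
    {J : FractionalIdeal P.D⁰ k} (hJ : J ≠ 0) (h : tOp P.D k J = J) :
    tOp P.R K (P.preimage K J) = P.preimage K J := by
  rw [P.tOp_preimage hU hJ, h]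

variable (K) in
/-- `J ↦ φ⁻¹(J)` on `t`-invertible `t`-ideals. -/
noncomputable def alphaInv (hU : Function.Surjective P.unitsMap) :
    (tOp P.D k).InvGroup →* (tOp P.R K).InvGroup :=
  MonoidHom.mk' (fun J => ⟨P.preimage K J.ideal,
    P.preimage_tOp_eq_self hU J.ideal_ne_zero J.star_ideal, by
      have h : J.ideal * J.ideal⁻¹ ≠ 0 := by
        intro h
        have := J.star_ideal_mul_inv
        rw [h, StarOperation.star_zero] at this
        exact zero_ne_one this
      rw [P.preimage_inv hU J.ideal_ne_zero, ← P.preimage_mul hU J.ideal_ne_zero,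
        P.tOp_preimage hU h, J.star_ideal_mul_inv, P.preimage_one]⟩) fun J J' => by
    apply InvGroup.ext_ideal
    change P.preimage K (tOp P.D k (J.ideal * J'.ideal)) =
      tOp P.R K (P.preimage K J.ideal * P.preimage K J'.ideal)
    rw [← P.preimage_mul hU J.ideal_ne_zero, P.tOp_preimage hU]
    exact ideal_mul_ne_zero J.ideal_ne_zero J'.ideal_ne_zero

theorem ideal_alphaInv (hU : Function.Surjective P.unitsMap) (J : (tOp P.D k).InvGroup) :
    (P.alphaInv K hU J).ideal = P.preimage K J.ideal := rfl

theorem prin_le_comap_alphaInv (hU : Function.Surjective P.unitsMap) :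
    (tOp P.D k).prin ≤ (tOp P.R K).prin.comap (P.alphaInv K hU) := by
  rintro J ⟨z, hz, hJ⟩
  obtain ⟨u, d, hu⟩ := P.exists_unit hU hz
  refine ⟨algebraMap T K u, P.ne_zero_of_map (u.isUnit.map P.φ).ne_zero, ?_⟩
  have h1 : ((d : P.D) : k) * (((d⁻¹ : P.Dˣ) : P.D) : k) = 1 :=
    congrArg Subtype.val (Units.mul_inv d)
  rw [ideal_alphaInv, hJ, ← P.preimage_spanSingleton u d⁻¹, hu, mul_assoc, h1, mul_one]

/-! ### The homomorphism β -/

/-- An element `g h` of `H H⁻¹` outside `M`, where `H` is `t`-invertible. -/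
theorem exists_mul_not_mem_ker {H : FractionalIdeal P.R⁰ K} (hH : tOp P.R K (H * H⁻¹) = 1) :
    ∃ h ∈ H, ∃ g ∈ H⁻¹, ∃ a : T, P.φ a ≠ 0 ∧ algebraMap T K a = h * g := by
  by_contra! hc
  obtain ⟨x, hx, hxt⟩ := P.exists_mem_not_ker (one_mem_of_star_eq_one _ hH)
  suffices ∃ t : T, P.φ t = 0 ∧ algebraMap T K t = x by
    obtain ⟨t, ht, h⟩ := this
    exact hxt t h ht
  -- M is closed under addition, so if every product of generators were in M, all of HH⁻¹ would be.
  refine FractionalIdeal.mul_induction_on hx (fun i hi j hj => ?_) ?_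
  · obtain ⟨t, -, ht⟩ := P.mem_one_R_iff.1 (mul_mem_one_of_mem_inv hi hj)
    refine ⟨t, ?_, ht⟩
    by_contra h0
    exact hc i hi j hj t h0 ht
  · rintro _ _ ⟨t, ht, rfl⟩ ⟨s, hs, rfl⟩
    exact ⟨t + s, by rw [map_add, ht, hs, add_zero], map_add _ _ _⟩

theorem ker_mul_mem_one_R {m : T} (hm : P.φ m = 0) {x : K} (hx : x ∈ (1 : FractionalIdeal T⁰ K)) :
    algebraMap T K m * x ∈ (1 : FractionalIdeal P.R⁰ K) := by
  obtain ⟨t, rfl⟩ := (FractionalIdeal.mem_one_iff _).1 hx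
  rw [← map_mul]
  exact P.algebraMap_mem_one_of_ker (by rw [map_mul, hm, zero_mul])

/-- M(HT) = MH ⊆ H because MT = M ⊆ R. This is the way back from T-modules to R-modules. -/
theorem ker_mul_mem_of_mem_extendIdeal {H : FractionalIdeal P.R⁰ K} {x : K}
    (hx : x ∈ extendIdeal T H) : ∀ m : T, P.φ m = 0 → algebraMap T K m * x ∈ H := by
  replace hx : x ∈ Submodule.span T {x | x ∈ H} := hx
  induction hx using Submodule.span_induction with
  | mem z hz => exact fun m hm => P.algebraMap_mul_mem (hm ▸ P.D.zero_mem) hz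
  | zero =>
    intro m _
    rw [mul_zero]
    exact Submodule.zero_mem (H : Submodule P.R K)
  | add a b _ _ ha hb =>
    intro m hm
    rw [mul_add]
    exact ideal_add_mem (ha m hm) (hb m hm)
  | smul t a _ ha =>
    intro m hm
    rw [Algebra.smul_def, ← mul_assoc, ← map_mul]
    exact ha _ (by rw [map_mul, hm, zero_mul])

/-- If `H` is `t`-invertible, then `Hᵗ ⊆ (HT)ᵛ`. -/
theorem tOp_le_vOp_extendIdeal {H : FractionalIdeal P.R⁰ K} (hH : tOp P.R K (H * H⁻¹) = 1)
    {E : FractionalIdeal T⁰ K} (hE : ∀ x ∈ H, x ∈ E) {x : K}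
    (hx : x ∈ tOp P.R K H) : x ∈ vOp T K E := by
  have hH0 := InvGroup.ne_zero_of_star hH
  obtain ⟨h, hh, g, hg, a, ha, hag⟩ := P.exists_mul_not_mem_ker hH
  have hE0 : E ≠ 0 := by
    refine ne_zero_of_mem (hE h hh) ?_
    rintro rfl
    rw [zero_mul] at hag
    exact P.ne_zero_of_map ha hag
  rw [mem_vOp_iff hE0]
  intro y hy
  -- Test xy ∈ T on a and on M. First, axy = (gx)(yh) with gx ∈ R because gH ⊆ R. Second, for m in
  -- M, myH ⊆ mT ⊆ R, hence myx ∈ R.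
  refine P.mem_of_ker_mul_mem (N := ((1 : FractionalIdeal T⁰ K) : Submodule T K)) ha ?_ ?_
  · have h1 : g * x ∈ (1 : FractionalIdeal P.R⁰ K) := by
      rw [← (tOp P.R K).star_one]
      refine mul_mem_of_forall_mul_mem _ (fun e he => ?_) hx
      rw [mul_comm]
      exact mul_mem_one_of_mem_inv he hg
    have h2 := one_T_mul_mem (P.mem_one_T_of_mem_one_R h1) (hy h (hE h hh))
    rw [hag, show h * g * (x * y) = g * x * (y * h) by ring]
    exact h2
  · intro m hm
    apply P.mem_one_T_of_mem_one_R
    rw [← (tOp P.R K).star_one, ← mul_assoc, mul_right_comm]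
    refine mul_mem_of_forall_mul_mem _ (fun e he => ?_) hx
    rw [mul_assoc]
    exact P.ker_mul_mem_one_R hm (hy e (hE e he))

/-- The star operation `(t_R)_T` on `T`. -/
noncomputable abbrev tT (K : Type*) [Field K] [Algebra T K] [IsFractionRing T K] :
    StarOperation T K := (tOp P.R K).extendStar P.conductorNeZero

theorem mem_tT {E : FractionalIdeal T⁰ K} {x : K} : x ∈ P.tT K E ↔
    x ∈ tOp P.R K (restrictIdeal P.conductorNeZero E) ∧ x ∈ vOp T K E := Iff.rfl

/-- Each half of the star operation on T serves one test for x ∈ HT. Since g(HT) ⊆ T, the v-half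
gives gx ∈ T and so ax = (gx)h ∈ HT; since M(HT) ⊆ H, the t-half gives Mx ⊆ Hᵗ = H. -/
theorem tT_extendIdeal {H : FractionalIdeal P.R⁰ K} (hH : tOp P.R K (H * H⁻¹) = 1)
    (hH' : tOp P.R K H = H) : P.tT K (extendIdeal T H) = extendIdeal T H := by
  refine le_antisymm ?_ ((P.tT K).le_self _)
  intro x hx
  obtain ⟨hx1, hx2⟩ := P.mem_tT.1 hx
  obtain ⟨h, hh, g, hg, a, ha, hag⟩ := P.exists_mul_not_mem_ker hH
  refine P.mem_of_ker_mul_mem (N := (extendIdeal T H : Submodule T K)) ha ?_ fun m hm => ?_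
  · have h1 : g * x ∈ (1 : FractionalIdeal T⁰ K) := by
      rw [← (vOp T K).star_one]
      refine mul_mem_of_forall_mul_mem _ (fun e he => ?_) hx2
      refine mul_mem_of_mem_extendIdeal (fun z hz => ?_) he
      rw [mul_comm]
      exact P.mem_one_T_of_mem_one_R (mul_mem_one_of_mem_inv hz hg)
    have h2 := one_T_mul_mem h1 (mem_extendIdeal T hh)
    rw [hag, show h * g * x = g * x * h by ring]
    exact h2
  · apply mem_extendIdeal T
    rw [← hH']
    exact mul_mem_of_forall_mul_mem _
      (fun e he => P.ker_mul_mem_of_mem_extendIdeal he m hm) hx1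

/-- The witness is H⁻¹T. Put B = (HT)(H⁻¹T) ⊆ T. The t-half is inherited from HH⁻¹ ⊆ B. For the
v-half, yB ⊆ T gives ay ∈ T, and My(HH⁻¹) ⊆ R gives My ⊆ R because 1 ∈ (HH⁻¹)ᵛ; hence y ∈ T. -/
theorem tT_extendIdeal_mul_inv {H : FractionalIdeal P.R⁰ K} (hH : tOp P.R K (H * H⁻¹) = 1) :
    P.tT K (extendIdeal T H * (extendIdeal T H)⁻¹) = 1 := by
  have hHB : ∀ z ∈ H * H⁻¹, z ∈ extendIdeal T H * extendIdeal T H⁻¹ := fun z hz =>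
    FractionalIdeal.mul_induction_on hz
      (fun i hi j hj => FractionalIdeal.mul_mem_mul (mem_extendIdeal T hi) (mem_extendIdeal T hj))
      (fun x y hx hy => ideal_add_mem hx hy)
  have h1 := one_mem_of_star_eq_one _ hH
  obtain ⟨h, hh, g, hg, a, ha, hag⟩ := P.exists_mul_not_mem_ker hH
  have hab : algebraMap T K a ∈ extendIdeal T H * extendIdeal T H⁻¹ :=
    hHB _ (hag ▸ FractionalIdeal.mul_mem_mul hh hg)
  apply InvGroup.star_mul_inv_of_mul (J := extendIdeal T H⁻¹)
  apply star_eq_one_of_mem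
  · exact extendIdeal_mul_le _ _ fun x hx y hy =>
      P.mem_one_T_of_mem_one_R (mul_mem_one_of_mem_inv hx hy)
  · refine P.mem_tT.2 ⟨(tOp P.R K).mono _ _ hHB h1, ?_⟩
    rw [mem_vOp_iff (ne_zero_of_mem hab (P.ne_zero_of_map ha))]
    intro y hy
    rw [one_mul]
    refine P.mem_of_ker_mul_mem (N := ((1 : FractionalIdeal T⁰ K) : Submodule T K)) ha ?_ ?_
    · rw [mul_comm]
      exact hy _ hab
    · intro m hm
      apply P.mem_one_T_of_mem_one_R
      rw [← one_mul (_ * y)]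
      have hne : H * H⁻¹ ≠ 0 :=
        ideal_mul_ne_zero (InvGroup.ne_zero_of_star hH)
          (inv_ne_zero_of_ne_zero (InvGroup.ne_zero_of_star hH))
      refine (mem_vOp_iff hne).1 (tOp_le_vOp _ h1) _ fun e he => ?_
      rw [mul_assoc]
      exact P.ker_mul_mem_one_R hm (hy e (hHB e he))

variable (K) in
/-- `H ↦ HT` on `t`-invertible `t`-ideals. -/
noncomputable def betaInv : (tOp P.R K).InvGroup →* (P.tT K).InvGroup :=
  MonoidHom.mk' (fun H => ⟨extendIdeal T H.ideal,
    P.tT_extendIdeal H.star_ideal_mul_inv H.star_ideal,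
    P.tT_extendIdeal_mul_inv H.star_ideal_mul_inv⟩) fun H H' => by
    apply InvGroup.ext_ideal
    change extendIdeal T (tOp P.R K (H.ideal * H'.ideal)) =
      P.tT K (extendIdeal T H.ideal * extendIdeal T H'.ideal)
    have hmul : ∀ x ∈ H.ideal * H'.ideal, x ∈ extendIdeal T H.ideal * extendIdeal T H'.ideal :=
      fun z hz => FractionalIdeal.mul_induction_on hz
        (fun i hi j hj => FractionalIdeal.mul_mem_mul (mem_extendIdeal T hi) (mem_extendIdeal T hj))
        (fun x y hx hy => ideal_add_mem hx hy)
    apply le_antisymm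
    · refine extendIdeal_le T fun x hx => P.mem_tT.2 ⟨(tOp P.R K).mono _ _ hmul hx, ?_⟩
      exact P.tOp_le_vOp_extendIdeal ((tOp P.R K).star_mul_mul_inv H.star_ideal_mul_inv
        H'.star_ideal_mul_inv) hmul hx
    · have h := P.tT_extendIdeal (H * H').star_ideal_mul_inv (H * H').star_ideal
      rw [InvGroup.ideal_mul] at h
      rw [← h]
      refine (P.tT K).mono _ _ (extendIdeal_mul_le _ _ fun x hx y hy => ?_)
      exact mem_extendIdeal T ((tOp P.R K).le_self _ (FractionalIdeal.mul_mem_mul hx hy))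

theorem ideal_betaInv (H : (tOp P.R K).InvGroup) :
    (P.betaInv K H).ideal = extendIdeal T H.ideal := rfl

theorem prin_le_comap_betaInv : (tOp P.R K).prin ≤ (P.tT K).prin.comap (P.betaInv K) := by
  rintro H ⟨x, hx, hH⟩
  refine ⟨x, hx, ?_⟩
  rw [ideal_betaInv, hH, extendIdeal_spanSingleton]

/-! ### Exactness in the middle -/

theorem extendIdeal_preimage (hU : Function.Surjective P.unitsMap) {J : FractionalIdeal P.D⁰ k}
    (hJ : J ≠ 0) : extendIdeal T (P.preimage K J) = 1 := by
  apply le_antisymm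
  · apply extendIdeal_le
    rintro _ ⟨t, -, rfl⟩
    exact algebraMap_mem_one_T t
  · rw [← FractionalIdeal.spanSingleton_one, FractionalIdeal.spanSingleton_le_iff_mem]
    obtain ⟨u, hu⟩ := P.exists_unit_mem hU hJ
    have h := one_T_mul_mem (algebraMap_mem_one_T ((u⁻¹ : Tˣ) : T))
      (mem_extendIdeal T (P.algebraMap_mem_preimage (K := K).2 hu))
    rwa [← map_mul, Units.inv_mul, map_one] at h

/-- A suitable multiple uH by a unit u of T lies between M and R. It is then a union of cosets of M,
hence the preimage of its image in k. -/
theorem exists_alphaInv_of_extendIdeal_eq_one (hU : Function.Surjective P.unitsMap)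
    (H : (tOp P.R K).InvGroup) (hH : extendIdeal T H.ideal = 1) :
    ∃ J, (tOp P.R K).cl (P.alphaInv K hU J) = (tOp P.R K).cl H := by
  have h1 : (1 : K) ∈ extendIdeal T H.ideal := hH ▸ FractionalIdeal.one_mem_one _
  have hHT : ∀ x ∈ H.ideal, ∃ t : T, algebraMap T K t = x := fun x hx =>
    (FractionalIdeal.mem_one_iff _).1 (hH ▸ mem_extendIdeal T hx)
  obtain ⟨h, hh, g, hg, a, ha, hag⟩ := P.exists_mul_not_mem_ker H.star_ideal_mul_inv
  have hgT : g * 1 ∈ (1 : FractionalIdeal T⁰ K) := by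
    refine mul_mem_of_mem_extendIdeal (fun y hy => ?_) h1
    rw [mul_comm]
    exact P.mem_one_T_of_mem_one_R (mul_mem_one_of_mem_inv hy hg)
  obtain ⟨b, hb⟩ := (FractionalIdeal.mem_one_iff _).1 hgT
  rw [mul_one] at hb
  obtain ⟨c, rfl⟩ := hHT h hh
  subst hb
  rw [← map_mul] at hag
  replace hag := IsFractionRing.injective T K hag
  rw [hag, map_mul] at ha
  -- Here g = b lies in T and bH ⊆ R, but bH need not contain M. Replacing b by a unit u with φ(u) ∈
  -- φ(b)U(D) keeps the image in k and gives uM = M.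
  obtain ⟨u, d, hu⟩ := P.exists_unit hU (right_ne_zero_of_mul ha)
  have huT := u.isUnit.map P.φ
  let I := InvGroup.smul (algebraMap T K u) (P.ne_zero_of_map huT.ne_zero) H
  have hIdef : I.ideal = FractionalIdeal.spanSingleton P.R⁰ (algebraMap T K u) * H.ideal := rfl
  have hI1 : I.ideal ≤ 1 := by
    rw [hIdef, FractionalIdeal.spanSingleton_mul_le_iff]
    intro x hx
    obtain ⟨t, rfl⟩ := hHT x hx
    have := mul_mem_one_of_mem_inv hx hg
    rw [← map_mul, P.algebraMap_mem_one_R_iff, map_mul] at this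
    rw [← map_mul, P.algebraMap_mem_one_R_iff, map_mul, hu, mul_assoc, mul_comm _ (P.φ t),
      ← mul_assoc, mul_comm (P.φ b)]
    exact P.D.mul_mem this (d : P.D).2
  have hIM : ∀ m : T, P.φ m = 0 → algebraMap T K m ∈ I.ideal := by
    intro m hm
    have h2 := P.ker_mul_mem_of_mem_extendIdeal h1 ((u⁻¹ : Tˣ) * m) (by rw [map_mul, hm, mul_zero])
    have h3 := FractionalIdeal.mul_mem_mul
      (FractionalIdeal.mem_spanSingleton_self P.R⁰ (algebraMap T K u)) h2
    rwa [mul_one, ← map_mul, Units.mul_inv_cancel_left] at h3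
  have hI : P.preimage K (P.image I.ideal) = I.ideal := by
    refine le_antisymm ?_ (P.le_preimage_image hI1)
    rintro _ ⟨t, ⟨s, -, hs, hst⟩, rfl⟩
    have := ideal_add_mem (hIM (t - s) (by rw [map_sub, hst, sub_self])) hs
    rwa [← map_add, sub_add_cancel] at this
  have hJ0 : P.image I.ideal ≠ 0 := by
    refine ne_zero_of_mem (P.image_mem hI1 (t := u * c) ?_) ?_
    · rw [map_mul]
      exact FractionalIdeal.mul_mem_mul (FractionalIdeal.mem_spanSingleton_self _ _) hh
    · rw [map_mul]
      exact mul_ne_zero huT.ne_zero (left_ne_zero_of_mul ha)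
  refine ⟨⟨P.image I.ideal, ?_, ?_⟩, ?_⟩
  · apply P.preimage_injective (K := K)
    rw [← P.tOp_preimage hU hJ0, hI, I.star_ideal]
  · apply P.preimage_injective (K := K)
    rw [← P.tOp_preimage hU (ideal_mul_ne_zero hJ0 (inv_ne_zero_of_ne_zero hJ0)),
      P.preimage_mul hU hJ0, ← P.preimage_inv hU hJ0, hI, I.star_ideal_mul_inv, P.preimage_one]
  · exact cl_eq_cl_of_smul _ (P.ne_zero_of_map huT.ne_zero) (hI.trans hIdef)

/-! ### Surjectivity of β -/

/-- The ideal H = E ∩ R works. Both ME and e lie in H, so HT = E by the test on e and M. -/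
theorem exists_extendIdeal_eq_of_mem (E : (P.tT K).InvGroup) (hE1 : E.ideal ≤ 1) {e : T}
    (he : P.φ e = 1) (heE : algebraMap T K e ∈ E.ideal) : ∃ H, P.betaInv K H = E := by
  have he0 : algebraMap T K e ≠ 0 := P.ne_zero_of_map (he ▸ one_ne_zero)
  have heR : algebraMap T K e ∈ (1 : FractionalIdeal P.R⁰ K) :=
    P.algebraMap_mem_one_R_iff.2 (he ▸ P.D.one_mem)
  let H : FractionalIdeal P.R⁰ K := restrictIdeal P.conductorNeZero E.ideal ⊓ 1
  -- J = E⁻¹ ∩ e⁻¹R is chosen so that HJ ⊆ R: for x ∈ H and y ∈ J, xy ∈ T and e(xy) = x(ey) ∈ R, and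
  -- φ(e) = 1 lets e be dropped modulo M.
  let J : FractionalIdeal P.R⁰ K := restrictIdeal P.conductorNeZero E.ideal⁻¹ ⊓
    FractionalIdeal.spanSingleton P.R⁰ (algebraMap T K e)⁻¹
  have mem_H : ∀ x, x ∈ H ↔ x ∈ E.ideal ∧ x ∈ (1 : FractionalIdeal P.R⁰ K) := fun x => Iff.rfl
  have mem_J : ∀ x, x ∈ J ↔ x ∈ E.ideal⁻¹ ∧
      algebraMap T K e * x ∈ (1 : FractionalIdeal P.R⁰ K) := by
    intro x
    refine and_congr Iff.rfl ?_
    change x ∈ FractionalIdeal.spanSingleton P.R⁰ (algebraMap T K e)⁻¹ ↔ _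
    rw [FractionalIdeal.mem_spanSingleton, FractionalIdeal.mem_one_iff]
    refine exists_congr fun r => ?_
    rw [Algebra.smul_def, ← div_eq_mul_inv, div_eq_iff he0, mul_comm x]
  have hMH : ∀ m : T, P.φ m = 0 → ∀ x ∈ E.ideal, algebraMap T K m * x ∈ H := fun m hm x hx =>
    (mem_H _).2 ⟨one_T_mul_mem (algebraMap_mem_one_T m) hx, P.ker_mul_mem_one_R hm (hE1 hx)⟩
  have hMJ : ∀ m : T, P.φ m = 0 → ∀ x ∈ E.ideal⁻¹, algebraMap T K m * x ∈ J := by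
    intro m hm x hx
    refine (mem_J _).2 ⟨one_T_mul_mem (algebraMap_mem_one_T m) hx, ?_⟩
    rw [mul_left_comm]
    exact P.ker_mul_mem_one_R hm (mul_mem_one_of_mem_inv heE hx)
  have heH : algebraMap T K e ∈ H := (mem_H _).2 ⟨heE, heR⟩
  have h1J : (1 : K) ∈ J := by
    refine (mem_J _).2 ⟨(FractionalIdeal.mem_inv_iff E.ideal_ne_zero).2 fun y hy => ?_, ?_⟩
    · rw [one_mul]
      exact hE1 hy
    · rwa [mul_one]
  have hHJ : H * J ≤ 1 := by
    rw [FractionalIdeal.mul_le]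
    intro x hx y hy
    obtain ⟨hx, hx'⟩ := (mem_H _).1 hx
    obtain ⟨hy, hy'⟩ := (mem_J _).1 hy
    obtain ⟨t, ht, rfl⟩ := P.mem_one_R_iff.1 hx'
    obtain ⟨s, hs⟩ := (FractionalIdeal.mem_one_iff _).1 (mul_mem_one_of_mem_inv hx hy)
    obtain ⟨r, hr, hr'⟩ := P.mem_one_R_iff.1 hy'
    rw [← hs, P.algebraMap_mem_one_R_iff]
    have : e * s = t * r := by
      apply IsFractionRing.injective T K
      rw [map_mul, map_mul, hs, hr', mul_left_comm]
    have h2 := congrArg P.φ this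
    rw [map_mul, he, one_mul, map_mul] at h2
    rw [h2]
    exact P.D.mul_mem ht hr
  have htH : tOp P.R K H = H := by
    refine le_antisymm (fun x hx => ?_) ((tOp P.R K).le_self _)
    have hx1 : x ∈ (1 : FractionalIdeal P.R⁰ K) := by
      rw [← (tOp P.R K).star_one]
      exact (tOp P.R K).mono _ _ inf_le_right hx
    refine (mem_H x).2 ⟨?_, hx1⟩
    rw [← E.star_ideal]
    refine P.mem_tT.2 ⟨(tOp P.R K).mono _ _ inf_le_left hx, ?_⟩
    rw [mem_vOp_iff E.ideal_ne_zero]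
    intro y hy
    refine P.mem_of_ker_mul_mem (N := ((1 : FractionalIdeal T⁰ K) : Submodule T K))
      (he ▸ one_ne_zero : P.φ e ≠ 0) ?_ fun m hm => ?_
    · have h2 := one_T_mul_mem (P.mem_one_T_of_mem_one_R hx1) (hy _ heE)
      rw [show algebraMap T K e * (x * y) = x * (y * algebraMap T K e) by ring]
      exact h2
    · apply P.mem_one_T_of_mem_one_R
      rw [← (tOp P.R K).star_one, ← mul_assoc, mul_right_comm]
      refine mul_mem_of_forall_mul_mem _ (fun z hz => ?_) hx
      rw [mul_assoc]
      exact P.ker_mul_mem_one_R hm (hy z ((mem_H z).1 hz).1)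
  have hm : P.φ (1 - e) = 0 := by rw [map_sub, map_one, he, sub_self]
  have hinv : tOp P.R K (H * J) = 1 := by
    refine star_eq_one_of_mem _ hHJ ?_
    -- As 1 - e ∈ M, (1 - e)²EE⁻¹ ⊆ HJ, so (1 - e)² ∈ (HJ)ᵗ. Also e = e · 1 ∈ HJ and 2 - e ∈ R, and
    -- (1 - e)² + (2 - e)e = 1.
    have h2 : algebraMap T K ((1 - e) * (1 - e)) * 1 ∈ tOp P.R K (H * J) := by
      refine mul_mem_of_forall_mul_mem _ (fun z hz => ?_)
        (P.mem_tT.1 (one_mem_of_star_eq_one _ E.star_ideal_mul_inv)).1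
      refine FractionalIdeal.mul_induction_on ((mem_restrictIdeal _).1 hz)
        (fun i hi j hj => ?_) (fun x y hx hy => ?_)
      · rw [map_mul, mul_mul_mul_comm]
        exact FractionalIdeal.mul_mem_mul (hMH _ hm i hi) (hMJ _ hm j hj)
      · rw [mul_add]
        exact ideal_add_mem hx hy
    have h3 : algebraMap T K (2 - e) * (algebraMap T K e * 1) ∈ tOp P.R K (H * J) := by
      refine P.algebraMap_mul_mem ?_
        ((tOp P.R K).le_self _ (FractionalIdeal.mul_mem_mul heH h1J))
      rw [map_sub, he, map_ofNat]
      exact P.D.sub_mem (ofNat_mem P.D 2) P.D.one_mem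
    have h4 := ideal_add_mem h2 h3
    rw [mul_one, mul_one, ← map_mul, ← map_add,
      show (1 - e) * (1 - e) + (2 - e) * e = 1 by ring, map_one] at h4
    exact h4
  refine ⟨⟨H, htH, InvGroup.star_mul_inv_of_mul hinv⟩, InvGroup.ext_ideal (le_antisymm ?_ ?_)⟩
  · exact extendIdeal_le T fun x hx => ((mem_H x).1 hx).1
  · intro x hx
    refine P.mem_of_ker_mul_mem (N := (extendIdeal T H : Submodule T K))
      (he ▸ one_ne_zero : P.φ e ≠ 0) ?_ fun m hm => mem_extendIdeal T (hMH m hm x hx)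
    have := one_T_mul_mem (hE1 hx) (mem_extendIdeal T heH)
    rwa [mul_comm] at this

/-- EE⁻¹ is not contained in M, so some f ∈ E⁻¹ gives fE ⊆ T with an element a outside M. An inverse
t of a modulo M then produces e = ta in fE with φ(e) = 1. -/
theorem exists_betaInv (E : (P.tT K).InvGroup) :
    ∃ H, (P.tT K).cl (P.betaInv K H) = (P.tT K).cl E := by
  obtain ⟨x, hx, hxt⟩ := P.exists_mem_not_ker
    (P.mem_tT.1 (one_mem_of_star_eq_one _ E.star_ideal_mul_inv)).1
  obtain ⟨f, hf, a, ha, haE⟩ : ∃ f ∈ E.ideal⁻¹, ∃ a : T, P.φ a ≠ 0 ∧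
      ∃ z ∈ E.ideal, algebraMap T K a = f * z := by
    by_contra! hc
    suffices ∃ t : T, P.φ t = 0 ∧ algebraMap T K t = x by
      obtain ⟨t, ht, h⟩ := this
      exact hxt t h ht
    refine FractionalIdeal.mul_induction_on ((mem_restrictIdeal _).1 hx)
      (fun i hi j hj => ?_) ?_
    · obtain ⟨t, ht⟩ := (FractionalIdeal.mem_one_iff _).1 (mul_mem_one_of_mem_inv hi hj)
      refine ⟨t, ?_, ht⟩
      by_contra h0
      exact hc j hj t h0 i hi (by rw [ht, mul_comm])
    · rintro _ _ ⟨t, ht, rfl⟩ ⟨s, hs, rfl⟩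
      exact ⟨t + s, by rw [map_add, ht, hs, add_zero], map_add _ _ _⟩
  obtain ⟨z, hz, hfz⟩ := haE
  have hf0 : f ≠ 0 := by
    rintro rfl
    rw [zero_mul] at hfz
    exact P.ne_zero_of_map ha hfz
  obtain ⟨t, ht⟩ := P.exists_sub_mul_mem_ker ha
  obtain ⟨H, hH⟩ := P.exists_extendIdeal_eq_of_mem (InvGroup.smul f hf0 E) (e := t * a) (by
      rw [InvGroup.ideal_smul, FractionalIdeal.spanSingleton_mul_le_iff]
      intro y hy
      rw [mul_comm]
      exact mul_mem_one_of_mem_inv hy hf)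
    (by rw [mul_comm]; rw [map_sub, map_one, sub_eq_zero] at ht; exact ht.symm) (by
      rw [map_mul, hfz]
      exact one_T_mul_mem (algebraMap_mem_one_T t)
        (FractionalIdeal.mul_mem_mul (FractionalIdeal.mem_spanSingleton_self _ _) hz))
  exact ⟨H, cl_eq_cl_of_smul _ hf0 (by rw [hH]; rfl)⟩

/-! ### The retraction γ -/

/-- If zG ⊆ D and s ∈ T lifts z, then sF ⊆ R, hence st ∈ R and zφ(t) ∈ D. Unlike the equality
`tOp_preimage`, this inclusion needs no unit of T in the ideals. -/
theorem map_mem_tOp {H : FractionalIdeal P.R⁰ K} {J : FractionalIdeal P.D⁰ k} (hJ : J ≠ 0)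
    (hHJ : H ≤ P.preimage K J) {t : T} (ht : algebraMap T K t ∈ tOp P.R K H) :
    P.φ t ∈ tOp P.D k J := by
  obtain ⟨F, hF, hFH, ht⟩ := mem_tOp_iff.1 ht
  obtain ⟨G, hG, hG0, hGJ, hFG⟩ := P.exists_fg_le_preimage_ne_zero hJ hF (hFH.trans hHJ)
  refine mem_tOp_iff.2 ⟨G, hG, hGJ, ?_⟩
  by_cases hF0 : F = 0
  · rw [hF0, StarOperation.star_zero, FractionalIdeal.mem_zero_iff,
      map_eq_zero_iff _ (IsFractionRing.injective T K)] at ht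
    rw [ht, map_zero]
    exact Submodule.zero_mem (vOp P.D k G : Submodule P.D k)
  rw [mem_vOp_iff hG0]
  intro z hz
  obtain ⟨s, rfl⟩ := P.surjective z
  rw [← map_mul, P.mem_one_iff_mem_D, ← P.algebraMap_mem_one_R_iff (K := K), map_mul]
  refine (mem_vOp_iff hF0).1 ht _ fun e he => ?_
  obtain ⟨r, hr, rfl⟩ := hFG he
  rw [← map_mul, P.algebraMap_mem_one_R_iff, ← P.mem_one_iff_mem_D, map_mul]
  exact hz _ hr

theorem image_ne_zero {H : FractionalIdeal P.R⁰ K} (hH : H ≤ 1) {t : T} (ht : P.φ t ≠ 0)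
    (htH : algebraMap T K t ∈ H) : P.image H ≠ 0 :=
  ne_zero_of_mem (P.image_mem hH htH) ht

/-- Closing in R before taking images does not matter after closing in D. This makes γ preserve
t-invertibility and products. -/
theorem tOp_image_tOp {H : FractionalIdeal P.R⁰ K} (hH : H ≤ 1) (h0 : P.image H ≠ 0) :
    tOp P.D k (P.image (tOp P.R K H)) = tOp P.D k (P.image H) := by
  apply le_antisymm
  · rw [← (tOp P.D k).idem (P.image H)]
    apply (tOp P.D k).mono
    rintro _ ⟨t, -, ht, rfl⟩
    exact P.map_mem_tOp h0 (P.le_preimage_image hH) ht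
  · apply (tOp P.D k).mono
    apply P.image_le
    exact ((tOp P.R K).le_self H).trans (P.le_preimage_image
      (((tOp P.R K).mono _ _ hH).trans (tOp P.R K).star_one.le))

theorem image_spanSingleton {a : T} (ha : P.φ a ∈ P.D) :
    P.image (FractionalIdeal.spanSingleton P.R⁰ (algebraMap T K a)) =
      FractionalIdeal.spanSingleton P.D⁰ (P.φ a) := by
  apply le_antisymm
  · apply P.image_le
    rw [FractionalIdeal.spanSingleton_le_iff_mem, P.algebraMap_mem_preimage]
    exact FractionalIdeal.mem_spanSingleton_self _ _
  · rw [FractionalIdeal.spanSingleton_le_iff_mem]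
    exact ⟨a, ha, FractionalIdeal.mem_spanSingleton_self _ _, rfl⟩

theorem image_smul {a : T} (ha : P.φ a ∈ P.D) {H : FractionalIdeal P.R⁰ K} (hH : H ≤ 1) :
    P.image (FractionalIdeal.spanSingleton P.R⁰ (algebraMap T K a) * H) =
      FractionalIdeal.spanSingleton P.D⁰ (P.φ a) * P.image H := by
  rw [P.image_mul _ hH, P.image_spanSingleton ha]
  exact FractionalIdeal.spanSingleton_le_iff_mem.2 (P.algebraMap_mem_one_R_iff.2 ha)

/-- `g H` is contained in `R` but not in `M`. -/
def IsNormalizer (H : FractionalIdeal P.R⁰ K) (g : K) : Prop :=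
  g ∈ H⁻¹ ∧ ∃ h ∈ H, ∃ a : T, P.φ a ≠ 0 ∧ algebraMap T K a = h * g

theorem exists_isNormalizer (H : (tOp P.R K).InvGroup) : ∃ g, P.IsNormalizer H.ideal g := by
  obtain ⟨h, hh, g, hg, a, ha, hag⟩ := P.exists_mul_not_mem_ker H.star_ideal_mul_inv
  exact ⟨g, hg, h, hh, a, ha, hag⟩

namespace IsNormalizer

variable {P} {H : FractionalIdeal P.R⁰ K} {g : K}

theorem smul_le_one (hg : P.IsNormalizer H g) : FractionalIdeal.spanSingleton P.R⁰ g * H ≤ 1 := by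
  rw [FractionalIdeal.spanSingleton_mul_le_iff]
  intro x hx
  rw [mul_comm]
  exact mul_mem_one_of_mem_inv hx hg.1

theorem image_ne_zero (hg : P.IsNormalizer H g) :
    P.image (FractionalIdeal.spanSingleton P.R⁰ g * H) ≠ 0 := by
  obtain ⟨h, hh, a, ha, hag⟩ := hg.2
  refine P.image_ne_zero hg.smul_le_one ha ?_
  rw [hag, mul_comm h g]
  exact FractionalIdeal.mul_mem_mul (FractionalIdeal.mem_spanSingleton_self _ _) hh

theorem of_smul_le_one (h : FractionalIdeal.spanSingleton P.R⁰ g * H ≤ 1) (hH : H ≠ 0) {x : K}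
    (hx : x ∈ H) {a : T} (ha : P.φ a ≠ 0) (hag : algebraMap T K a = x * g) :
    P.IsNormalizer H g := by
  refine ⟨(FractionalIdeal.mem_inv_iff hH).2 fun y hy => h ?_, x, hx, a, ha, hag⟩
  exact FractionalIdeal.mul_mem_mul (FractionalIdeal.mem_spanSingleton_self _ _) hy

/-- From (gH)(hH⁻¹) = aHH⁻¹, taking images gives φ(gH)φ(hH⁻¹) = φ(a)φ(HH⁻¹), and φ(HH⁻¹)ᵗ = D. So
φ(a)⁻¹φ(hH⁻¹) is an inverse up to t. -/
theorem star_mul_inv (hg : P.IsNormalizer H g) (hH : tOp P.R K (H * H⁻¹) = 1) :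
    tOp P.D k (tOp P.D k (P.image (FractionalIdeal.spanSingleton P.R⁰ g * H)) *
      (tOp P.D k (P.image (FractionalIdeal.spanSingleton P.R⁰ g * H)))⁻¹) = 1 := by
  obtain ⟨h, hh, a, ha, hag⟩ := hg.2
  have haD : P.φ a ∈ P.D := by
    rw [← P.algebraMap_mem_one_R_iff (K := K), hag]
    exact mul_mem_one_of_mem_inv hh hg.1
  have hB1 : H * H⁻¹ ≤ 1 := InvGroup.mul_inv_le H
  have h' : FractionalIdeal.spanSingleton P.R⁰ h * H⁻¹ ≤ 1 := by
    rw [FractionalIdeal.spanSingleton_mul_le_iff]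
    exact fun x hx => mul_mem_one_of_mem_inv hh hx
  have hB0 : P.image (H * H⁻¹) ≠ 0 :=
    P.image_ne_zero hB1 ha (hag ▸ FractionalIdeal.mul_mem_mul hh hg.1)
  have hB : tOp P.D k (P.image (H * H⁻¹)) = 1 := by
    rw [← P.tOp_image_tOp hB1 hB0, hH, ← P.preimage_one, P.image_preimage le_rfl,
      (tOp P.D k).star_one]
  apply InvGroup.star_mul_inv_of_mul (J := FractionalIdeal.spanSingleton P.D⁰ (P.φ a)⁻¹ *
    P.image (FractionalIdeal.spanSingleton P.R⁰ h * H⁻¹))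
  rw [star_mul_left, mul_left_comm, ← P.image_mul hg.smul_le_one h', mul_mul_mul_comm,
    FractionalIdeal.spanSingleton_mul_spanSingleton, mul_comm g h, ← hag, P.image_smul haD hB1,
    ← mul_assoc, FractionalIdeal.spanSingleton_mul_spanSingleton, inv_mul_cancel₀ ha,
    FractionalIdeal.spanSingleton_one, one_mul, hB]

end IsNormalizer

/-- The `t`-ideal `φ(g H)ᵗ` of `D`. -/
noncomputable def imageInv (H : (tOp P.R K).InvGroup) {g : K} (hg : P.IsNormalizer H.ideal g) :
    (tOp P.D k).InvGroup :=
  ⟨tOp P.D k (P.image (FractionalIdeal.spanSingleton P.R⁰ g * H.ideal)), (tOp P.D k).idem _,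
    hg.star_mul_inv H.star_ideal_mul_inv⟩

theorem ideal_imageInv (H : (tOp P.R K).InvGroup) {g : K} (hg : P.IsNormalizer H.ideal g) :
    (P.imageInv H hg).ideal =
      tOp P.D k (P.image (FractionalIdeal.spanSingleton P.R⁰ g * H.ideal)) := rfl

/-- With a = hg and a' = hg', a(g'H) = a'(gH), so the two images differ by the factor φ(a')/φ(a). -/
theorem cl_imageInv_eq (H : (tOp P.R K).InvGroup) {g g' : K} (hg : P.IsNormalizer H.ideal g)
    (hg' : P.IsNormalizer H.ideal g') :
    (tOp P.D k).cl (P.imageInv H hg') = (tOp P.D k).cl (P.imageInv H hg) := by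
  obtain ⟨h, hh, a, ha, hag⟩ := hg.2
  obtain ⟨h', hh', b, hb, hbg⟩ := hg'.2
  obtain ⟨a', ha', hag'⟩ := P.mem_one_R_iff.1 (mul_mem_one_of_mem_inv hh hg'.1)
  obtain ⟨b', -, hbg'⟩ := P.mem_one_R_iff.1 (mul_mem_one_of_mem_inv hh' hg.1)
  have haD : P.φ a ∈ P.D := by
    rw [← P.algebraMap_mem_one_R_iff (K := K), hag]
    exact mul_mem_one_of_mem_inv hh hg.1
  -- Both sides are hg · h'g'. As φ(a) and φ(b) are nonzero, so is φ(a'), although h was chosen for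
  -- g and not for g'.
  have hab : a * b = a' * b' := by
    apply IsFractionRing.injective T K
    rw [map_mul, map_mul, hag, hbg, hag', hbg']
    ring
  have ha'0 : P.φ a' ≠ 0 := by
    have := congrArg P.φ hab
    rw [map_mul, map_mul] at this
    exact left_ne_zero_of_mul (this ▸ mul_ne_zero ha hb)
  have key : FractionalIdeal.spanSingleton P.R⁰ (algebraMap T K a) *
      (FractionalIdeal.spanSingleton P.R⁰ g' * H.ideal) =
      FractionalIdeal.spanSingleton P.R⁰ (algebraMap T K a') *
      (FractionalIdeal.spanSingleton P.R⁰ g * H.ideal) := by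
    rw [← mul_assoc, ← mul_assoc, FractionalIdeal.spanSingleton_mul_spanSingleton,
      FractionalIdeal.spanSingleton_mul_spanSingleton, hag, hag', mul_right_comm]
  have key' := congrArg (fun I => tOp P.D k (P.image I)) key
  simp only [P.image_smul haD hg'.smul_le_one, P.image_smul ha' hg.smul_le_one,
    (tOp P.D k).star_smul _ _ ha, (tOp P.D k).star_smul _ _ ha'0] at key'
  refine cl_eq_cl_of_smul _ (mul_ne_zero (inv_ne_zero ha) ha'0) ?_
  rw [ideal_imageInv, ideal_imageInv, ← FractionalIdeal.spanSingleton_mul_spanSingleton, mul_assoc,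
    ← key', ← mul_assoc, FractionalIdeal.spanSingleton_mul_spanSingleton, inv_mul_cancel₀ ha,
    FractionalIdeal.spanSingleton_one, one_mul]

theorem exists_isNormalizer_mul (H H' : (tOp P.R K).InvGroup) {g g' : K}
    (hg : P.IsNormalizer H.ideal g) (hg' : P.IsNormalizer H'.ideal g') :
    ∃ hgg' : P.IsNormalizer (H * H').ideal (g * g'),
      P.imageInv (H * H') hgg' = P.imageInv H hg * P.imageInv H' hg' := by
  obtain ⟨h, hh, a, ha, hag⟩ := hg.2
  obtain ⟨h', hh', a', ha', hag'⟩ := hg'.2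
  have hg0 : g * g' ≠ 0 := by
    refine mul_ne_zero ?_ ?_ <;> rintro rfl
    · exact P.ne_zero_of_map ha (by rw [hag, mul_zero])
    · exact P.ne_zero_of_map ha' (by rw [hag', mul_zero])
  have heq : FractionalIdeal.spanSingleton P.R⁰ (g * g') * (H * H').ideal =
      tOp P.R K ((FractionalIdeal.spanSingleton P.R⁰ g * H.ideal) *
        (FractionalIdeal.spanSingleton P.R⁰ g' * H'.ideal)) := by
    rw [InvGroup.ideal_mul, ← (tOp P.R K).star_smul _ _ hg0,
      ← FractionalIdeal.spanSingleton_mul_spanSingleton, mul_mul_mul_comm]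
  have hle : (FractionalIdeal.spanSingleton P.R⁰ g * H.ideal) *
      (FractionalIdeal.spanSingleton P.R⁰ g' * H'.ideal) ≤ 1 :=
    mul_le_one' hg.smul_le_one hg'.smul_le_one
  refine ⟨.of_smul_le_one ?_ (H * H').ideal_ne_zero (x := h * h') ?_ (a := a * a') ?_ ?_,
    InvGroup.ext_ideal ?_⟩
  · rw [heq, ← (tOp P.R K).star_one]
    exact (tOp P.R K).mono _ _ hle
  · exact (tOp P.R K).le_self _ (FractionalIdeal.mul_mem_mul hh hh')
  · rw [map_mul]
    exact mul_ne_zero ha ha'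
  · rw [map_mul, hag, hag', mul_mul_mul_comm]
  · rw [ideal_imageInv, heq, InvGroup.ideal_mul, ideal_imageInv, ideal_imageInv,
      star_mul_left, star_mul_right, ← P.image_mul hg.smul_le_one hg'.smul_le_one,
      P.tOp_image_tOp hle]
    rw [P.image_mul hg.smul_le_one hg'.smul_le_one]
    exact ideal_mul_ne_zero hg.image_ne_zero hg'.image_ne_zero

variable (K) in
/-- `H ↦ [φ(g H)ᵗ]`, where `g H` is contained in `R` but not in `M`. -/
noncomputable def gammaInv : (tOp P.R K).InvGroup →* (tOp P.D k).Cl :=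
  MonoidHom.mk' (fun H => (tOp P.D k).cl (P.imageInv H (P.exists_isNormalizer H).choose_spec))
    fun H H' => by
      obtain ⟨hgg', h⟩ := P.exists_isNormalizer_mul H H' (P.exists_isNormalizer H).choose_spec
        (P.exists_isNormalizer H').choose_spec
      rw [← map_mul, ← h]
      exact P.cl_imageInv_eq _ _ _

theorem gammaInv_apply (H : (tOp P.R K).InvGroup) {g : K} (hg : P.IsNormalizer H.ideal g) :
    P.gammaInv K H = (tOp P.D k).cl (P.imageInv H hg) :=
  P.cl_imageInv_eq _ _ _

theorem prin_le_ker_gammaInv : (tOp P.R K).prin ≤ (P.gammaInv K).ker := by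
  rintro H ⟨x, hx, hH⟩
  have h1 : FractionalIdeal.spanSingleton P.R⁰ x⁻¹ * H.ideal = 1 := by
    rw [hH, FractionalIdeal.spanSingleton_mul_spanSingleton, inv_mul_cancel₀ hx,
      FractionalIdeal.spanSingleton_one]
  have hg : P.IsNormalizer H.ideal x⁻¹ := .of_smul_le_one h1.le H.ideal_ne_zero
    (hH ▸ FractionalIdeal.mem_spanSingleton_self _ x) (a := 1) (by simp)
    (by rw [map_one, mul_inv_cancel₀ hx])
  rw [MonoidHom.mem_ker, P.gammaInv_apply H hg, ← map_one (tOp P.D k).cl]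
  congr 1
  apply InvGroup.ext_ideal
  rw [ideal_imageInv, h1, ← P.preimage_one, P.image_preimage le_rfl, (tOp P.D k).star_one,
    InvGroup.ideal_one]

/-- Take as normalizer a lift b of a common denominator d of J. The image of bφ⁻¹(J) is dJ, even
though bφ⁻¹(J) need not be all of φ⁻¹(dJ). A unit u with φ(u) ∈ J shows that bφ⁻¹(J) is not
contained in M. -/
theorem gammaInv_alphaInv (hU : Function.Surjective P.unitsMap) (J : (tOp P.D k).InvGroup) :
    P.gammaInv K (P.alphaInv K hU J) = (tOp P.D k).cl J := by
  obtain ⟨d, hd, hdJ⟩ := J.ideal.isFractional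
  have hd0 : (d : k) ≠ 0 := fun h => nonZeroDivisors.ne_zero hd (Subtype.ext h)
  obtain ⟨u, hu⟩ := P.exists_unit_mem hU J.ideal_ne_zero
  obtain ⟨b, hb⟩ := P.surjective d
  have hJ1 : FractionalIdeal.spanSingleton P.D⁰ (d : k) * J.ideal ≤ 1 := by
    rw [FractionalIdeal.spanSingleton_mul_le_iff]
    intro z hz
    obtain ⟨c, hc⟩ := hdJ z hz
    exact (FractionalIdeal.mem_one_iff _).2 ⟨c, hc⟩
  have hle : FractionalIdeal.spanSingleton P.R⁰ (algebraMap T K b) * P.preimage K J.ideal ≤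
      P.preimage K (FractionalIdeal.spanSingleton P.D⁰ (d : k) * J.ideal) := by
    rw [FractionalIdeal.spanSingleton_mul_le_iff]
    rintro _ ⟨t, ht, rfl⟩
    rw [← map_mul, P.algebraMap_mem_preimage, map_mul, hb]
    exact FractionalIdeal.mul_mem_mul (FractionalIdeal.mem_spanSingleton_self _ _) ht
  have h1 : FractionalIdeal.spanSingleton P.R⁰ (algebraMap T K b) * P.preimage K J.ideal ≤ 1 := by
    rw [← P.preimage_one]
    exact hle.trans (P.preimage_le_iff.2 hJ1)
  have hg : P.IsNormalizer (P.alphaInv K hU J).ideal (algebraMap T K b) :=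
    .of_smul_le_one h1 (P.alphaInv K hU J).ideal_ne_zero
      (P.algebraMap_mem_preimage.2 hu) (a := u * b) (by
        rw [map_mul, hb]
        exact mul_ne_zero (u.isUnit.map P.φ).ne_zero hd0) (map_mul _ _ _)
  rw [P.gammaInv_apply _ hg]
  refine cl_eq_cl_of_smul _ hd0 ?_
  rw [ideal_imageInv]
  refine Eq.trans ?_ (((tOp P.D k).star_smul (d : k) J.ideal hd0).trans (by rw [J.star_ideal]))
  congr 1
  refine le_antisymm (P.image_le hle) ?_
  rw [FractionalIdeal.spanSingleton_mul_le_iff]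
  intro z hz
  obtain ⟨t, rfl⟩ := P.surjective z
  rw [← hb, ← map_mul]
  refine P.image_mem h1 ?_
  rw [map_mul]
  exact FractionalIdeal.mul_mem_mul (FractionalIdeal.mem_spanSingleton_self _ _)
    (P.algebraMap_mem_preimage.2 hz)

end PullbackSquarePlus

/-! ### The split exact sequence -/

theorem mainTheorem2 {T K k : Type*} [CommRing T] [IsDomain T] [Field K] [Algebra T K]
    [IsFractionRing T K] [Field k] (P : PullbackSquarePlus T k)
    (hU : Function.Surjective P.unitsMap) :
    ∃ (α : (StarOperation.tOp P.D k).Cl →* (StarOperation.tOp P.R K).Cl)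
      (β : (StarOperation.tOp P.R K).Cl →*
        ((StarOperation.tOp P.R K).extendStar P.conductorNeZero).Cl),
      (∀ J : (StarOperation.tOp P.D k).InvGroup, ∃ I : (StarOperation.tOp P.R K).InvGroup,
        I.ideal = P.preimage K J.ideal ∧ α (StarOperation.cl _ J) = StarOperation.cl _ I) ∧
      (∀ H : (StarOperation.tOp P.R K).InvGroup,
        ∃ I : ((StarOperation.tOp P.R K).extendStar P.conductorNeZero).InvGroup,
          I.ideal = StarOperation.extendIdeal T H.ideal ∧
            β (StarOperation.cl _ H) = StarOperation.cl _ I) ∧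
      IsSplitShortExact α β := by
  let α : (StarOperation.tOp P.D k).Cl →* (StarOperation.tOp P.R K).Cl :=
    QuotientGroup.map _ _ (P.alphaInv K hU) (P.prin_le_comap_alphaInv hU)
  let β : (StarOperation.tOp P.R K).Cl →* (P.tT K).Cl :=
    QuotientGroup.map _ _ (P.betaInv K) P.prin_le_comap_betaInv
  let γ : (StarOperation.tOp P.R K).Cl →* (StarOperation.tOp P.D k).Cl :=
    QuotientGroup.lift _ (P.gammaInv K) P.prin_le_ker_gammaInv
  have hα : ∀ J, α (StarOperation.cl _ J) = StarOperation.cl _ (P.alphaInv K hU J) :=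
    fun _ => rfl
  have hβ : ∀ H, β (StarOperation.cl _ H) = StarOperation.cl _ (P.betaInv K H) := fun _ => rfl
  have hγ : γ.comp α = MonoidHom.id _ := by
    ext J
    exact P.gammaInv_alphaInv hU J
  refine ⟨α, β, fun J => ⟨_, rfl, hα J⟩, fun H => ⟨_, rfl, hβ H⟩, ?_, ?_, ?_, γ, hγ⟩
  · exact Function.LeftInverse.injective (g := γ) fun x => DFunLike.congr_fun hγ x
  · apply le_antisymm
    · rintro _ ⟨x, rfl⟩
      obtain ⟨J, rfl⟩ := QuotientGroup.mk_surjective x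
      refine (QuotientGroup.eq_one_iff _).2 ⟨1, one_ne_zero, ?_⟩
      rw [FractionalIdeal.spanSingleton_one]
      exact P.extendIdeal_preimage hU J.ideal_ne_zero
    · intro y hy
      obtain ⟨H, rfl⟩ := QuotientGroup.mk_surjective y
      obtain ⟨x, hx, hH⟩ := (QuotientGroup.eq_one_iff _).1 (MonoidHom.mem_ker.1 hy)
      rw [P.ideal_betaInv] at hH
      -- From HT = xT, passing to x⁻¹H gives extension T without changing the class.
      obtain ⟨J, hJ⟩ := P.exists_alphaInv_of_extendIdeal_eq_one hU
        (.smul x⁻¹ (inv_ne_zero hx) H) (by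
          rw [StarOperation.InvGroup.ideal_smul, StarOperation.extendIdeal_smul, hH,
            FractionalIdeal.spanSingleton_mul_spanSingleton, inv_mul_cancel₀ hx,
            FractionalIdeal.spanSingleton_one])
      exact ⟨StarOperation.cl _ J, hJ.trans
        (StarOperation.cl_eq_cl_of_smul _ (inv_ne_zero hx) rfl)⟩
  · intro y
    obtain ⟨E, rfl⟩ := QuotientGroup.mk_surjective y
    obtain ⟨H, hH⟩ := P.exists_betaInv E
    exact ⟨StarOperation.cl _ H, hH⟩
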